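/- Notation. For a piecewise $C^1$ function $f$ on $\mathbb R$ put $E^f=\int_{\mathbb R}(f^2+f_x^2)\,dx$, $C^{\alpha,f}=\int_{\mathbb R}(f^2+f_x^2)e^{\alpha|x|}\,dx$ and $P^f=\frac12 e^{-|\cdot|}*\big(f^2+\tfrac12 f_x^2\big)$. A (global, conservative) multi-peakon solution of the Camassa–Holm equation $u_t+(u^2/2)_x+P^u_x=0$ is a function $$u(t,x)=\sum_{i=1}^N p_i(t)e^{-|x-q_i(t)|},\qquad t,x\in\mathbb R,$$ for which there is a set $S\subset\mathbb R$ of interaction times, finite on every bounded interval, with $0\notin S$, such that: (i) for $t\notin S$ one has $q_1(t)<\dots<q_N(t)$, and $p_i,q_i$ are differentiable at $t$ with $$\dot q_i=\sum_{j}p_je^{-|q_i-q_j|},\qquad \dot p_i=p_i\sum_{j}p_j\,\mathrm{sign}(q_i-q_j)e^{-|q_i-q_j|};$$ (ii) each $q_i$ is continuous on $\mathbb R$; (iii) if $\tau\in S$ and $q_a,\dots,q_b$ are exactly the peakons that meet at a given position at time $\tau$ (possibly $a=b$), then $\sum_{i=a}^b p_i(t)\to\sum_{i=a}^b p_i(\tau)$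 as $t\to\tau$, $t\ne\tau$, and the energy $\int_{q_a(t)}^{q_b(t)}u_x^2(t,x)\,dx$ has one and the same finite limit as $t\to\tau^-$ and as $t\to\tau^+$. Lemma (A-priori bounds). Let $0<\alpha<1$. For all real numbers $K,E$ there is a continuous function $C=C_{K,E}:\mathbb R\to\mathbb R$, depending only on $\alpha$, $K$ and $E$, with the following property. Let $u$ be a multi-peakon solution whose initial datum $\bar u=u(0,\cdot)$ satisfies $C^{\alpha,\bar u}<\infty$, and let $K=C^{\alpha,\bar u}$, $E=E^{\bar u}$. Then, for every $t\in\mathbb R$, the integral in (1) converges, $P^u(t,\cdot)$ is differentiable on $\mathbb R$, $u_x(t,\cdot)\in L^1(\mathbb R)$, and $$\text{(1)}\quad \int_{\mathbb R}\big[u^2(t,x)+u_x^2(t,x)\big]e^{\alpha|x|}\,dx\le C(t),$$ $$\text{(2)}\quad \sup_{x\in\mathbb R}|P^u_x(t,x)|\,e^{\alpha|x|}\le C(t),\qquad \text{(3)}\quad \|u_x(t,\cdot)\|_{L^1(\mathbb R)}\le C(t).$$ -/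

import Mathlib

open Filter Topology MeasureTheory

/-- The multi-peakon profile `x ↦ ∑ᵢ pᵢ e^{-|x - qᵢ|}` with strengths `p` and positions `q`. -/
noncomputable def multipeakon {N : ℕ} (p q : Fin N → ℝ) (x : ℝ) : ℝ :=
  ∑ i, p i * Real.exp (-|x - q i|)

/-- The energy density `f² + f_x²`. For the piecewise smooth functions `f` considered here,
`deriv f` is the weak derivative of `f` (it is the classical one off finitely many points). -/
noncomputable def energyDensity (f : ℝ → ℝ) (x : ℝ) : ℝ :=
  f x ^ 2 + deriv f x ^ 2

/-- The energy `∫ (f² + f_x²) dx`. -/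
noncomputable def energy (f : ℝ → ℝ) : ℝ :=
  ∫ x, energyDensity f x

/-- The weighted energy `∫ (f² + f_x²) e^{α|x|} dx`. It is meaningful when
`HasFiniteWeightedEnergy α f` holds. -/
noncomputable def weightedEnergy (α : ℝ) (f : ℝ → ℝ) : ℝ :=
  ∫ x, energyDensity f x * Real.exp (α * |x|)

/-- Finiteness of the weighted energy, the condition that singles out the space `X_α`. -/
def HasFiniteWeightedEnergy (α : ℝ) (f : ℝ → ℝ) : Prop :=
  Integrable (fun x => energyDensity f x * Real.exp (α * |x|))

/-- The nonlocal term `½ e^{-|·|} * (f² + f_x² / 2)` of the Camassa–Holm equation. -/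
noncomputable def nonlocalP (f : ℝ → ℝ) (x : ℝ) : ℝ :=
  (1 / 2) * ∫ y, Real.exp (-|x - y|) * (f y ^ 2 + deriv f y ^ 2 / 2)

/-- The strengths `p` and the positions `q` are those of an energy-conserving multi-peakon solution,
defined for all times, with set of interaction times `S`.

The indices `a, a + 1, …, b` form a *cluster* at the time `τ` when these are exactly the peakons
which occupy the position `q τ a` at that time. -/
structure IsConservativeMultipeakonFlow {N : ℕ} (p q : ℝ → Fin N → ℝ) (S : Set ℝ) : Prop where
  /-- Interaction times do not accumulate. -/
  locallyFinite : ∀ a b : ℝ, (S ∩ Set.Icc a b).Finite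
  /-- The initial time is not an interaction time. -/
  zero_notMem : (0 : ℝ) ∉ S
  /-- Away from the interaction times the peakons have distinct positions, and are labelled from
  left to right. -/
  strictMono : ∀ t ∉ S, StrictMono (q t)
  /-- Away from the interaction times: `q̇ᵢ = ∑ⱼ pⱼ e^{-|qᵢ - qⱼ|}`. -/
  deriv_q : ∀ t ∉ S, ∀ i, HasDerivAt (fun s => q s i)
    (∑ j, p t j * Real.exp (-|q t i - q t j|)) t
  /-- Away from the interaction times: `ṗᵢ = pᵢ ∑ⱼ pⱼ sign (qᵢ - qⱼ) e^{-|qᵢ - qⱼ|}`. -/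
  deriv_p : ∀ t ∉ S, ∀ i, HasDerivAt (fun s => p s i)
    (p t i * ∑ j, p t j * Real.sign (q t i - q t j) * Real.exp (-|q t i - q t j|)) t
  /-- Positions are continuous through the interactions. -/
  continuous_q : ∀ i, Continuous (fun t => q t i)
  /-- The total strength of every cluster is continuous through the interaction. For a cluster of
  one peakon this is the continuity of its strength; in a larger one the individual strengths may
  blow up. -/
  strength : ∀ τ ∈ S, ∀ a b : Fin N, (∀ i, q τ i = q τ a ↔ a ≤ i ∧ i ≤ b) →
    Tendsto (fun t => ∑ i ∈ Finset.Icc a b, p t i) (𝓝[≠] τ) (𝓝 (∑ i ∈ Finset.Icc a b, p τ i))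
  /-- Conservation of energy: the energy `∫ u_x² dx` carried by the part of the solution between the
  first and the last peakon of a cluster has the same limit `e` before and after the interaction. -/
  energy : ∀ τ ∈ S, ∀ a b : Fin N, (∀ i, q τ i = q τ a ↔ a ≤ i ∧ i ≤ b) →
    ∃ e : ℝ, Tendsto (fun t => ∫ x in (q t a)..(q t b), deriv (multipeakon (p t) (q t)) x ^ 2)
      (𝓝[≠] τ) (𝓝 e)

/-- `u : (t, x) ↦ u t x` is a (global, conservative) multi-peakon solution of the Camassa–Holm
equation. -/
def IsMultipeakonSolution (u : ℝ → ℝ → ℝ) : Prop :=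
  ∃ (N : ℕ) (p q : ℝ → Fin N → ℝ) (S : Set ℝ),
    IsConservativeMultipeakonFlow p q S ∧ ∀ t x, u t x = multipeakon (p t) (q t) x

variable {N : ℕ}

/-! ### Truncated exponentials -/

/-! The quantities propagated are the energies `expEnergy β` with the smooth weight `e^{βx}`, `|β| <
1`. Taking `β = ±α` recovers the weight `e^{α|x|}`, since `e^{α|x|} ≤ e^{αx} + e^{-αx}`, and bounds
(2) and (3) follow from (1) at each fixed time.

Away from interactions, the conservation law `½(u² + u_x²)_t + (u(P + u_x²/2))_x = 0` suggests that
the energy with weight `e^{βx}` has rate `2β ∫ u (P + u_x²/2) e^{βx}`. No weak formulation is used: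
for a multi-peakon, energy and flux are a quadratic and a cubic form in the strengths with explicit
kernels, and the ODE system gives the identity once the cubic kernels are symmetrized
(`symmSum_energyRateKernel`, `hasDerivAt_expEnergy`). For `β = 0` the rate vanishes. For `|β| < 1`
it is at most a constant times `√E` times the weighted energy itself, because `|u| ≤ √E`
(`two_mul_multipeakon_sq_le`) and the source `P + u_x²/2` is nonnegative with weighted integral
controlled by the weighted energy (`integral_energySource_le`).

At an interaction time single strengths may blow up, but the weighted energy still has a two-sided
limit (`exists_tendsto_expEnergy`). Outside the shrinking intervals spanned by the clusters, the
solution depends only on the cluster moments `∑ p_j e^{∓q_j}`. These converge because the total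
strengths do and the energy stays bounded (`tendsto_sum_cluster_exp_sub`), so dominated convergence
gives the energy of the limiting profile. Inside those intervals the weight is asymptotically
constant and `u²` is negligible, so the assumed common limit of `∫ u_x²` takes over. The
concentrated part is nonnegative, hence the value at the interaction time does not exceed the limit.
Replacing the values on `S` by these limits gives a continuous function, to which a Gronwall
estimate with countably many exceptional times applies (`expEnergy_le_of_rate`). -/

theorem integrable_ite_lt_exp {c : ℝ} (hc : 0 < c) (m : ℝ) :
    Integrable (fun x : ℝ => if x < m then Real.exp (c * x) else 0) := by
  have h := (integrableOn_exp_mul_Iic hc m).mono_set Set.Iio_subset_Iic_self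
  simpa [Set.indicator] using! h.integrable_indicator measurableSet_Iio

theorem integral_ite_lt_exp {c : ℝ} (hc : 0 < c) (m : ℝ) :
    ∫ x : ℝ, (if x < m then Real.exp (c * x) else 0) = Real.exp (c * m) / c := by
  rw [← integral_exp_mul_Iic hc m, integral_Iic_eq_integral_Iio, ← integral_indicator measurableSet_Iio]
  simp [Set.indicator]

theorem integrable_ite_le_exp {c : ℝ} (hc : c < 0) (m : ℝ) :
    Integrable (fun x : ℝ => if m ≤ x then Real.exp (c * x) else 0) := by
  have h := (integrableOn_Ici_iff_integrableOn_Ioi (by simp)).2 (integrableOn_exp_mul_Ioi hc m)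
  simpa [Set.indicator] using! h.integrable_indicator measurableSet_Ici

theorem integral_ite_le_exp {c : ℝ} (hc : c < 0) (m : ℝ) :
    ∫ x : ℝ, (if m ≤ x then Real.exp (c * x) else 0) = -Real.exp (c * m) / c := by
  rw [← integral_exp_mul_Ioi hc m, ← integral_Ici_eq_integral_Ioi, ← integral_indicator measurableSet_Ici]
  simp [Set.indicator]

theorem integrable_ite_Ico_exp (c a b : ℝ) :
    Integrable (fun x : ℝ => if a ≤ x ∧ x < b then Real.exp (c * x) else 0) := by
  have h : IntegrableOn (fun x : ℝ => Real.exp (c * x)) (Set.Ico a b) :=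
    (Continuous.integrableOn_Icc (by fun_prop)).mono_set Set.Ico_subset_Icc_self
  exact (h.integrable_indicator measurableSet_Ico).congr
    (ae_of_all _ fun x => by simp [Set.indicator_apply, Set.mem_Ico])

/-- Keeping the factor `c` on the left avoids a division and so includes `c = 0`; the maximum on the
right accounts for an empty interval. -/
theorem mul_integral_ite_Ico_exp (c a b : ℝ) :
    c * ∫ x : ℝ, (if a ≤ x ∧ x < b then Real.exp (c * x) else 0) =
      Real.exp (c * max a b) - Real.exp (c * a) := by
  have h1 : ∫ x : ℝ, (if a ≤ x ∧ x < b then Real.exp (c * x) else 0)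
      = ∫ x in Set.Ico a b, Real.exp (c * x) := by
    rw [← integral_indicator measurableSet_Ico]
    simp [Set.indicator]
  rw [h1, integral_Ico_eq_integral_Ioc]
  rcases le_total a b with h | h
  · rw [← intervalIntegral.integral_of_le h, max_eq_right h, ← intervalIntegral.integral_const_mul]
    refine intervalIntegral.integral_eq_sub_of_hasDerivAt (f := fun x => Real.exp (c * x)) ?_
      (Continuous.intervalIntegrable (by fun_prop) _ _)
    intro x _
    simpa [mul_comm] using ((hasDerivAt_id x).const_mul c).exp
  · simp [Set.Ioc_eq_empty_of_le h, max_eq_left h]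

/-! ### The decomposition `f = A eˣ + B e⁻ˣ` of a multi-peakon -/

/-- The coefficient of `eˣ` in a multi-peakon. -/
noncomputable def expCoeff {N : ℕ} (p q : Fin N → ℝ) (x : ℝ) : ℝ :=
  ∑ i, if x < q i then p i * Real.exp (-q i) else 0

/-- The coefficient of `e⁻ˣ` in a multi-peakon. -/
noncomputable def expNegCoeff {N : ℕ} (p q : Fin N → ℝ) (x : ℝ) : ℝ :=
  ∑ i, if q i ≤ x then p i * Real.exp (q i) else 0

/-- The energy density of a multi-peakon in terms of its exponential coefficients. -/
noncomputable def peakonDensity {N : ℕ} (p q : Fin N → ℝ) (x : ℝ) : ℝ :=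
  2 * (expCoeff p q x ^ 2 * Real.exp (2 * x) + expNegCoeff p q x ^ 2 * Real.exp (-(2 * x)))

/-- The energy of a multi-peakon with respect to the weight `e^{βx}`. -/
noncomputable def expEnergy {N : ℕ} (β : ℝ) (p q : Fin N → ℝ) : ℝ :=
  ∫ x, peakonDensity p q x * Real.exp (β * x)

theorem multipeakon_eq_expCoeff (p q : Fin N → ℝ) (x : ℝ) :
    multipeakon p q x = expCoeff p q x * Real.exp x + expNegCoeff p q x * Real.exp (-x) := by
  simp only [multipeakon, expCoeff, expNegCoeff, Finset.sum_mul, ← Finset.sum_add_distrib]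
  refine Finset.sum_congr rfl fun i _ => ?_
  rcases lt_or_ge x (q i) with h | h
  · rw [if_pos h, if_neg (not_le.2 h), abs_of_neg (by linarith), mul_assoc, ← Real.exp_add]
    ring_nf
  · rw [if_neg (not_lt.2 h), if_pos h, abs_of_nonneg (by linarith), zero_mul, mul_assoc,
      ← Real.exp_add]
    ring_nf

theorem hasDerivAt_multipeakon (p q : Fin N → ℝ) {x : ℝ} (hx : ∀ i, x ≠ q i) :
    HasDerivAt (multipeakon p q)
      (expCoeff p q x * Real.exp x - expNegCoeff p q x * Real.exp (-x)) x := by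
  have key : ∀ i, HasDerivAt (fun y => p i * Real.exp (-|y - q i|))
      ((if x < q i then p i * Real.exp (-q i) else 0) * Real.exp x
        - (if q i ≤ x then p i * Real.exp (q i) else 0) * Real.exp (-x)) x := by
    intro i
    rcases lt_or_gt_of_ne (hx i) with h | h
    · have h1 : HasDerivAt (fun y => p i * Real.exp (y - q i)) (p i * Real.exp (x - q i)) x := by
        simpa using (((hasDerivAt_id x).sub_const (q i)).exp).const_mul (p i)
      rw [if_pos h, if_neg (not_le.2 h), mul_assoc, ← Real.exp_add]
      refine (h1.congr_of_eventuallyEq ?_).congr_deriv (by ring_nf)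
      · filter_upwards [Iio_mem_nhds h] with y hy
        rw [abs_of_neg (by linarith [Set.mem_Iio.1 hy]), neg_neg]
    · have h1 : HasDerivAt (fun y => p i * Real.exp (-(y - q i)))
          (p i * (Real.exp (-(x - q i)) * (-1))) x := by
        simpa using ((((hasDerivAt_id x).sub_const (q i)).neg).exp).const_mul (p i)
      rw [if_neg (not_lt.2 h.le), if_pos h.le, mul_assoc, ← Real.exp_add]
      refine (h1.congr_of_eventuallyEq ?_).congr_deriv (by ring_nf)
      · filter_upwards [Ioi_mem_nhds h] with y hy
        rw [abs_of_pos (by linarith [Set.mem_Ioi.1 hy])]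
  have := HasDerivAt.fun_sum (u := Finset.univ) fun i _ => key i
  simp only [Finset.sum_sub_distrib, ← Finset.sum_mul] at this
  exact this

theorem ae_forall_ne (q : Fin N → ℝ) : ∀ᵐ x : ℝ, ∀ i, x ≠ q i := by
  rw [ae_all_iff]
  intro i
  simp [ae_iff]

theorem deriv_multipeakon_ae (p q : Fin N → ℝ) : deriv (multipeakon p q) =ᵐ[volume]
    fun x => expCoeff p q x * Real.exp x - expNegCoeff p q x * Real.exp (-x) := by
  filter_upwards [ae_forall_ne q] with x hx using (hasDerivAt_multipeakon p q hx).deriv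

theorem energyDensity_multipeakon_ae (p q : Fin N → ℝ) :
    energyDensity (multipeakon p q) =ᵐ[volume] peakonDensity p q := by
  filter_upwards [deriv_multipeakon_ae p q] with x hx
  have e1 : Real.exp (2 * x) = Real.exp x ^ 2 := by rw [← Real.exp_nat_mul]; norm_num
  have e2 : Real.exp (-(2 * x)) = Real.exp (-x) ^ 2 := by
    rw [← Real.exp_nat_mul]; congr 1; push_cast; ring
  rw [energyDensity, hx, multipeakon_eq_expCoeff, peakonDensity, e1, e2]
  ring

theorem peakonDensity_nonneg (p q : Fin N → ℝ) (x : ℝ) : 0 ≤ peakonDensity p q x := by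
  unfold peakonDensity; positivity

/-! ### The weighted energy as a quadratic form -/

/-- The kernel of the quadratic form `expEnergy β`. -/
noncomputable def energyKernel (β a b : ℝ) : ℝ :=
  2 * (Real.exp (-a - b) * (Real.exp ((2 + β) * min a b) / (2 + β)) +
    Real.exp (a + b) * (Real.exp ((β - 2) * max a b) / (2 - β)))

theorem expCoeff_sq_mul (β : ℝ) (p q : Fin N → ℝ) (x : ℝ) :
    expCoeff p q x ^ 2 * Real.exp (2 * x) * Real.exp (β * x) = ∑ i, ∑ j, p i * p j *
      (Real.exp (-q i - q j) * if x < min (q i) (q j) then Real.exp ((2 + β) * x) else 0) := by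
  rw [mul_assoc, ← Real.exp_add, ← add_mul, pow_two, expCoeff, Finset.sum_mul_sum, Finset.sum_mul]
  refine Finset.sum_congr rfl fun i _ => ?_
  rw [Finset.sum_mul]
  refine Finset.sum_congr rfl fun j _ => ?_
  by_cases hi : x < q i <;> by_cases hj : x < q j <;> simp [hi, hj, sub_eq_add_neg, Real.exp_add]
  ring

theorem expNegCoeff_sq_mul (β : ℝ) (p q : Fin N → ℝ) (x : ℝ) :
    expNegCoeff p q x ^ 2 * Real.exp (-(2 * x)) * Real.exp (β * x) = ∑ i, ∑ j, p i * p j *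
      (Real.exp (q i + q j) * if max (q i) (q j) ≤ x then Real.exp ((β - 2) * x) else 0) := by
  have e : -(2 * x) + β * x = (β - 2) * x := by ring
  rw [mul_assoc, ← Real.exp_add, e, pow_two, expNegCoeff, Finset.sum_mul_sum,
    Finset.sum_mul]
  refine Finset.sum_congr rfl fun i _ => ?_
  rw [Finset.sum_mul]
  refine Finset.sum_congr rfl fun j _ => ?_
  by_cases hi : q i ≤ x <;> by_cases hj : q j ≤ x <;> simp [hi, hj, Real.exp_add]
  ring

theorem integrable_expCoeff_sq {β : ℝ} (h : -2 < β) (p q : Fin N → ℝ) :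
    Integrable fun x => expCoeff p q x ^ 2 * Real.exp (2 * x) * Real.exp (β * x) := by
  simp only [expCoeff_sq_mul]
  exact integrable_finsetSum _ fun i _ => integrable_finsetSum _ fun j _ =>
    ((integrable_ite_lt_exp (by linarith) _).const_mul _).const_mul _

theorem integrable_expNegCoeff_sq {β : ℝ} (h : β < 2) (p q : Fin N → ℝ) :
    Integrable fun x => expNegCoeff p q x ^ 2 * Real.exp (-(2 * x)) * Real.exp (β * x) := by
  simp only [expNegCoeff_sq_mul]
  exact integrable_finsetSum _ fun i _ => integrable_finsetSum _ fun j _ =>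
    ((integrable_ite_le_exp (by linarith) _).const_mul _).const_mul _

theorem integral_expCoeff_sq {β : ℝ} (h : -2 < β) (p q : Fin N → ℝ) :
    ∫ x, expCoeff p q x ^ 2 * Real.exp (2 * x) * Real.exp (β * x) = ∑ i, ∑ j, p i * p j *
      (Real.exp (-q i - q j) * (Real.exp ((2 + β) * min (q i) (q j)) / (2 + β))) := by
  have hI := fun i j => ((integrable_ite_lt_exp (c := 2 + β) (by linarith)
    (min (q i) (q j))).const_mul (Real.exp (-q i - q j))).const_mul (p i * p j)
  simp only [expCoeff_sq_mul]
  rw [integral_finsetSum _ fun i _ => integrable_finsetSum _ fun j _ => hI i j]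
  refine Finset.sum_congr rfl fun i _ => ?_
  rw [integral_finsetSum _ fun j _ => hI i j]
  refine Finset.sum_congr rfl fun j _ => ?_
  rw [integral_const_mul, integral_const_mul, integral_ite_lt_exp (by linarith)]

theorem integral_expNegCoeff_sq {β : ℝ} (h : β < 2) (p q : Fin N → ℝ) :
    ∫ x, expNegCoeff p q x ^ 2 * Real.exp (-(2 * x)) * Real.exp (β * x) = ∑ i, ∑ j, p i * p j *
      (Real.exp (q i + q j) * (Real.exp ((β - 2) * max (q i) (q j)) / (2 - β))) := by
  have hI := fun i j => ((integrable_ite_le_exp (c := β - 2) (by linarith)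
    (max (q i) (q j))).const_mul (Real.exp (q i + q j))).const_mul (p i * p j)
  simp only [expNegCoeff_sq_mul]
  rw [integral_finsetSum _ fun i _ => integrable_finsetSum _ fun j _ => hI i j]
  refine Finset.sum_congr rfl fun i _ => ?_
  rw [integral_finsetSum _ fun j _ => hI i j]
  refine Finset.sum_congr rfl fun j _ => ?_
  rw [integral_const_mul, integral_const_mul, integral_ite_le_exp (by linarith), neg_div,
    ← div_neg, neg_sub]

theorem peakonDensity_mul_exp (β : ℝ) (p q : Fin N → ℝ) (x : ℝ) :
    peakonDensity p q x * Real.exp (β * x) =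
      2 * (expCoeff p q x ^ 2 * Real.exp (2 * x) * Real.exp (β * x)) +
      2 * (expNegCoeff p q x ^ 2 * Real.exp (-(2 * x)) * Real.exp (β * x)) := by
  rw [peakonDensity]; ring

theorem integrable_peakonDensity {β : ℝ} (h : |β| < 2) (p q : Fin N → ℝ) :
    Integrable fun x => peakonDensity p q x * Real.exp (β * x) := by
  simp only [peakonDensity_mul_exp]
  exact ((integrable_expCoeff_sq (abs_lt.1 h).1 p q).const_mul 2).add
    ((integrable_expNegCoeff_sq (abs_lt.1 h).2 p q).const_mul 2)

theorem expEnergy_eq_add {β : ℝ} (h : |β| < 2) (p q : Fin N → ℝ) :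
    expEnergy β p q =
      2 * (∫ x, expCoeff p q x ^ 2 * Real.exp (2 * x) * Real.exp (β * x)) +
      2 * ∫ x, expNegCoeff p q x ^ 2 * Real.exp (-(2 * x)) * Real.exp (β * x) := by
  simp only [expEnergy, peakonDensity_mul_exp]
  rw [integral_add ((integrable_expCoeff_sq (abs_lt.1 h).1 p q).const_mul 2)
    ((integrable_expNegCoeff_sq (abs_lt.1 h).2 p q).const_mul 2), integral_const_mul,
    integral_const_mul]

theorem expEnergy_eq_sum {β : ℝ} (h : |β| < 2) (p q : Fin N → ℝ) :
    expEnergy β p q = ∑ i, ∑ j, p i * p j * energyKernel β (q i) (q j) := by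
  rw [expEnergy_eq_add h, integral_expCoeff_sq (abs_lt.1 h).1, integral_expNegCoeff_sq (abs_lt.1 h).2,
    Finset.mul_sum, Finset.mul_sum, ← Finset.sum_add_distrib]
  refine Finset.sum_congr rfl fun i _ => ?_
  rw [Finset.mul_sum, Finset.mul_sum, ← Finset.sum_add_distrib]
  refine Finset.sum_congr rfl fun j _ => ?_
  rw [energyKernel]; ring

theorem expEnergy_nonneg (β : ℝ) (p q : Fin N → ℝ) : 0 ≤ expEnergy β p q :=
  integral_nonneg fun x => mul_nonneg (peakonDensity_nonneg p q x) (Real.exp_pos _).le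

theorem energyKernel_zero (a b : ℝ) : energyKernel 0 a b = 2 * Real.exp (-|a - b|) := by
  unfold energyKernel
  rcases le_total a b with h | h
  · rw [min_eq_left h, max_eq_right h, abs_of_nonpos (by linarith), mul_div_assoc',
      ← Real.exp_add, mul_div_assoc', ← Real.exp_add]
    ring_nf
  · rw [min_eq_right h, max_eq_left h, abs_of_nonneg (by linarith), mul_div_assoc',
      ← Real.exp_add, mul_div_assoc', ← Real.exp_add]
    ring_nf

/-- The kernel `e^{-|a-b|}` reproduces point values in `H¹`. Adding a peakon of strength `-u(x)` at
`x` changes the energy from `E` to `E - 4u(x)² + 2u(x)²`, which is again nonnegative. -/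
theorem two_mul_multipeakon_sq_le (p q : Fin N → ℝ) (x : ℝ) :
    2 * multipeakon p q x ^ 2 ≤ expEnergy 0 p q := by
  have h := expEnergy_nonneg 0 (Fin.cons (-multipeakon p q x) p : Fin (N + 1) → ℝ) (Fin.cons x q)
  rw [expEnergy_eq_sum (by norm_num)] at h ⊢
  simp only [Fin.sum_univ_succ, Fin.cons_zero, Fin.cons_succ, energyKernel_zero, sub_self,
    abs_zero, neg_zero, Real.exp_zero] at h ⊢
  have h1 : ∑ i, -multipeakon p q x * p i * (2 * Real.exp (-|x - q i|))
      = -2 * multipeakon p q x ^ 2 := by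
    rw [pow_two, ← mul_assoc]
    conv_rhs => arg 2; rw [multipeakon]
    rw [Finset.mul_sum]
    exact Finset.sum_congr rfl fun i _ => by ring
  have h2 : ∑ i, p i * -multipeakon p q x * (2 * Real.exp (-|q i - x|))
      = -2 * multipeakon p q x ^ 2 := by
    rw [← h1]
    exact Finset.sum_congr rfl fun i _ => by rw [abs_sub_comm]; ring
  rw [Finset.sum_add_distrib, h1, h2] at h
  nlinarith

/-! ### The energy source -/

/-- The density `P + f_x² / 2` which governs the transport of energy, for a multi-peakon `f`. -/
noncomputable def energySource {N : ℕ} (p q : Fin N → ℝ) (x : ℝ) : ℝ :=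
  ∑ j, ∑ k, p j * p k *
    ((if x < min (q j) (q k) then Real.exp (x - max (q j) (q k)) else 0) +
      if max (q j) (q k) ≤ x then Real.exp (min (q j) (q k) - x) else 0)

/-- `e^{min(a,b)}` is the Gram kernel `∫ 1_{x<a} 1_{x<b} eˣ dx`. It is read off from
`integral_expCoeff_sq` at `β = -1`, with the strengths rescaled to cancel the factors `e^{-q_j}`. -/
theorem sum_mul_exp_min_nonneg (p q : Fin N → ℝ) :
    0 ≤ ∑ j, ∑ k, p j * p k * Real.exp (min (q j) (q k)) := by
  have h := integral_expCoeff_sq (β := -1) (by norm_num) (fun j => p j * Real.exp (q j)) q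
  have h0 : (0 : ℝ) ≤ ∫ x, expCoeff (fun j => p j * Real.exp (q j)) q x ^ 2 * Real.exp (2 * x) *
    Real.exp (-1 * x) := integral_nonneg fun x => by positivity
  rw [h] at h0
  refine h0.trans_eq (Finset.sum_congr rfl fun j _ => Finset.sum_congr rfl fun k _ => ?_)
  have e : Real.exp (-q j - q k) = (Real.exp (q j))⁻¹ * (Real.exp (q k))⁻¹ := by
    rw [sub_eq_add_neg, Real.exp_add, Real.exp_neg, Real.exp_neg]
  rw [e]
  norm_num
  field_simp

theorem sum_mul_exp_neg_max_nonneg (p q : Fin N → ℝ) :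
    0 ≤ ∑ j, ∑ k, p j * p k * Real.exp (-max (q j) (q k)) := by
  have h := sum_mul_exp_min_nonneg p (fun j => -q j)
  simpa only [min_neg_neg] using h

/-- Only pairs on the same side of `x` contribute, so the source is a sum of two positive
semidefinite forms, in the strengths right of `x` and in those left of it. -/
theorem energySource_nonneg (p q : Fin N → ℝ) (x : ℝ) : 0 ≤ energySource p q x := by
  have h1 := sum_mul_exp_neg_max_nonneg (fun j => if x < q j then p j else 0) q
  have h2 := sum_mul_exp_min_nonneg (fun j => if q j ≤ x then p j else 0) q
  have h : energySource p q x =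
      Real.exp x * (∑ j, ∑ k, (if x < q j then p j else 0) * (if x < q k then p k else 0) *
        Real.exp (-max (q j) (q k))) +
      Real.exp (-x) * ∑ j, ∑ k, (if q j ≤ x then p j else 0) * (if q k ≤ x then p k else 0) *
        Real.exp (min (q j) (q k)) := by
    simp only [energySource, Finset.mul_sum, ← Finset.sum_add_distrib]
    refine Finset.sum_congr rfl fun j _ => Finset.sum_congr rfl fun k _ => ?_
    rw [sub_eq_add_neg, Real.exp_add, sub_eq_add_neg, Real.exp_add]
    by_cases hj : x < q j <;> by_cases hk : x < q k <;>
      simp [hj, hk, not_lt.1, not_le.2] <;> ring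
  rw [h]
  positivity

theorem energySource_mul_exp (β : ℝ) (p q : Fin N → ℝ) (x : ℝ) :
    energySource p q x * Real.exp (β * x) = ∑ j, ∑ k, p j * p k *
      (Real.exp (-max (q j) (q k)) *
        (if x < min (q j) (q k) then Real.exp ((1 + β) * x) else 0) +
      Real.exp (min (q j) (q k)) *
        if max (q j) (q k) ≤ x then Real.exp ((β - 1) * x) else 0) := by
  simp only [energySource, Finset.sum_mul]
  refine Finset.sum_congr rfl fun j _ => Finset.sum_congr rfl fun k _ => ?_
  have e1 : Real.exp ((1 + β) * x) = Real.exp x * Real.exp (β * x) := by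
    rw [← Real.exp_add]; ring_nf
  have e2 : Real.exp ((β - 1) * x) = Real.exp (-x) * Real.exp (β * x) := by
    rw [← Real.exp_add]; ring_nf
  rw [e1, e2, sub_eq_add_neg, Real.exp_add, sub_eq_add_neg, Real.exp_add, mul_assoc, add_mul]
  congr 2 <;> split_ifs <;> ring

theorem integrable_energySource {β : ℝ} (h : |β| < 1) (p q : Fin N → ℝ) :
    Integrable fun x => energySource p q x * Real.exp (β * x) := by
  obtain ⟨h1, h2⟩ := abs_lt.1 h
  simp only [energySource_mul_exp]
  exact integrable_finsetSum _ fun j _ => integrable_finsetSum _ fun k _ =>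
    (((integrable_ite_lt_exp (by linarith) _).const_mul _).add
      ((integrable_ite_le_exp (by linarith) _).const_mul _)).const_mul _

/-- Because `min + max` of a pair is its sum, the two halves of the source have, pair by pair, the
same exponentials as the `eˣ` and `e⁻ˣ` parts of the energy; only the denominators differ. The
denominators `1 ± β` are what restricts `β` to `|β| < 1`. -/
theorem integral_energySource {β : ℝ} (h : |β| < 1) (p q : Fin N → ℝ) :
    ∫ x, energySource p q x * Real.exp (β * x) =
      (2 + β) / (1 + β) *
        (∫ x, expCoeff p q x ^ 2 * Real.exp (2 * x) * Real.exp (β * x)) +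
      (2 - β) / (1 - β) *
        ∫ x, expNegCoeff p q x ^ 2 * Real.exp (-(2 * x)) * Real.exp (β * x) := by
  obtain ⟨h1, h2⟩ := abs_lt.1 h
  have hI1 := fun j k => (integrable_ite_lt_exp (c := 1 + β) (by linarith)
    (min (q j) (q k))).const_mul (Real.exp (-max (q j) (q k)))
  have hI2 := fun j k => (integrable_ite_le_exp (c := β - 1) (by linarith)
    (max (q j) (q k))).const_mul (Real.exp (min (q j) (q k)))
  have hI := fun j k => ((hI1 j k).add (hI2 j k)).const_mul (p j * p k)
  simp only [Pi.add_apply] at hI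
  rw [integral_expCoeff_sq (by linarith), integral_expNegCoeff_sq (by linarith)]
  simp only [energySource_mul_exp, Finset.mul_sum, ← Finset.sum_add_distrib]
  rw [integral_finsetSum _ fun i _ => integrable_finsetSum _ fun j _ => hI i j]
  refine Finset.sum_congr rfl fun j _ => ?_
  rw [integral_finsetSum _ fun k _ => hI j k]
  refine Finset.sum_congr rfl fun k _ => ?_
  rw [integral_const_mul, integral_add (hI1 j k) (hI2 j k), integral_const_mul,
    integral_const_mul, integral_ite_lt_exp (by linarith), integral_ite_le_exp (by linarith)]
  have hmm := min_add_max (q j) (q k)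
  have e1 : Real.exp (-q j - q k) * Real.exp ((2 + β) * min (q j) (q k)) =
      Real.exp (-max (q j) (q k)) * Real.exp ((1 + β) * min (q j) (q k)) := by
    rw [← Real.exp_add, ← Real.exp_add]; congr 1; linear_combination hmm
  have e2 : Real.exp (q j + q k) * Real.exp ((β - 2) * max (q j) (q k)) =
      Real.exp (min (q j) (q k)) * Real.exp ((β - 1) * max (q j) (q k)) := by
    rw [← Real.exp_add, ← Real.exp_add]; congr 1; linear_combination -hmm
  rw [← mul_div_assoc (Real.exp (-q j - q k)), e1, ← mul_div_assoc (Real.exp (q j + q k)), e2]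
  have n1 : 1 + β ≠ 0 := by linarith
  have n2 : 1 - β ≠ 0 := by linarith
  have n3 : 2 + β ≠ 0 := by linarith
  have n4 : 2 - β ≠ 0 := by linarith
  have n5 : β - 1 ≠ 0 := by linarith
  rw [← neg_sub 1 β]
  field_simp

theorem integral_energySource_le {β : ℝ} (h : |β| < 1) (p q : Fin N → ℝ) :
    ∫ x, energySource p q x * Real.exp (β * x) ≤ 3 / (2 * (1 - |β|)) * expEnergy β p q := by
  -- The numerators are at most `3` and the denominators at least `1 - |β|`.
  have h1 : (2 + β) / (1 + β) ≤ 3 / (1 - |β|) := by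
    have := neg_abs_le β
    have := le_abs_self β
    apply div_le_div₀ <;> linarith
  have h2 : (2 - β) / (1 - β) ≤ 3 / (1 - |β|) := by
    have := neg_abs_le β
    have := le_abs_self β
    apply div_le_div₀ <;> linarith
  have h3 : (0 : ℝ) ≤ ∫ x, expCoeff p q x ^ 2 * Real.exp (2 * x) * Real.exp (β * x) :=
    integral_nonneg fun x => by positivity
  have h4 : (0 : ℝ) ≤ ∫ x, expNegCoeff p q x ^ 2 * Real.exp (-(2 * x)) * Real.exp (β * x) :=
    integral_nonneg fun x => by positivity
  rw [integral_energySource h, expEnergy_eq_add (by linarith)]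
  have n : 1 - |β| ≠ 0 := by linarith
  calc _ ≤ 3 / (1 - |β|) * _ + 3 / (1 - |β|) * _ :=
        add_le_add (mul_le_mul_of_nonneg_right h1 h3) (mul_le_mul_of_nonneg_right h2 h4)
    _ = _ := by
      rw [← mul_add, ← mul_add, ← mul_assoc]
      congr 1
      field_simp

/-- The kernel of the cubic form `2 β ∫ f (P + f_x² / 2) e^{βx}`. -/
noncomputable def fluxKernel (β a b c : ℝ) : ℝ :=
  2 * (Real.exp (-a - max b c) * (β * (Real.exp ((2 + β) * min a (min b c)) / (2 + β))) +
    Real.exp (a - max b c) * (Real.exp (β * max a (min b c)) - Real.exp (β * a)) +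
    Real.exp (min b c - a) * (Real.exp (β * max (max b c) a) - Real.exp (β * max b c)) +
    Real.exp (a + min b c) * (β * (Real.exp ((β - 2) * max a (max b c)) / (2 - β))))

theorem multipeakon_mul_energySource_mul_exp (β : ℝ) (p q : Fin N → ℝ) (x : ℝ) :
    multipeakon p q x * energySource p q x * Real.exp (β * x) = ∑ i, ∑ j, ∑ k, p i * p j * p k *
      (Real.exp (-q i - max (q j) (q k)) *
        (if x < min (q i) (min (q j) (q k)) then Real.exp ((2 + β) * x) else 0) +
      Real.exp (q i - max (q j) (q k)) *
        (if q i ≤ x ∧ x < min (q j) (q k) then Real.exp (β * x) else 0) +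
      Real.exp (min (q j) (q k) - q i) *
        (if max (q j) (q k) ≤ x ∧ x < q i then Real.exp (β * x) else 0) +
      Real.exp (q i + min (q j) (q k)) *
        (if max (q i) (max (q j) (q k)) ≤ x then Real.exp ((β - 2) * x) else 0)) := by
  rw [multipeakon, Finset.sum_mul, Finset.sum_mul]
  refine Finset.sum_congr rfl fun i _ => ?_
  rw [energySource, Finset.mul_sum, Finset.sum_mul]
  refine Finset.sum_congr rfl fun j _ => ?_
  rw [Finset.mul_sum, Finset.sum_mul]
  refine Finset.sum_congr rfl fun k _ => ?_
  have e1 : Real.exp ((2 + β) * x) = Real.exp x * Real.exp x * Real.exp (β * x) := by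
    rw [← Real.exp_add, ← Real.exp_add]; ring_nf
  have e2 : Real.exp ((β - 2) * x) = (Real.exp x)⁻¹ * (Real.exp x)⁻¹ * Real.exp (β * x) := by
    rw [← Real.exp_neg, ← Real.exp_add, ← Real.exp_add]; ring_nf
  -- Only the minimum and maximum of the pair enter from here on; their order excludes the case `M ≤
  -- x < m`.
  have hmM : min (q j) (q k) ≤ max (q j) (q k) := min_le_max
  generalize min (q j) (q k) = m at *
  generalize max (q j) (q k) = M at *
  rw [e1, e2]
  have hx := (Real.exp_pos x).ne'
  have ha := (Real.exp_pos (q i)).ne'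
  have hm := (Real.exp_pos m).ne'
  have hM := (Real.exp_pos M).ne'
  have habs1 : x < q i → |x - q i| = q i - x := fun h => by
    rw [abs_of_neg (by linarith), neg_sub]
  have habs2 : q i ≤ x → |x - q i| = x - q i := fun h => abs_of_nonneg (by linarith)
  rcases lt_or_ge x (q i) with h | h <;> rcases lt_or_ge x m with h1 | h1 <;>
    rcases lt_or_ge x M with h2 | h2 <;> try linarith
  all_goals
    simp [h, h1, h2, habs1, habs2, not_lt_of_ge, not_le_of_gt,
      Real.exp_sub, Real.exp_neg, Real.exp_add]
  all_goals (try field_simp)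

theorem integral_multipeakon_mul_energySource {β : ℝ} (h : |β| < 2) (p q : Fin N → ℝ) :
    2 * β * (∫ x, multipeakon p q x * energySource p q x * Real.exp (β * x)) =
      ∑ i, ∑ j, ∑ k, p i * p j * p k * fluxKernel β (q i) (q j) (q k) := by
  obtain ⟨h1, h2⟩ := abs_lt.1 h
  have hI1 := fun i j k => (integrable_ite_lt_exp (c := 2 + β) (by linarith)
    (min (q i) (min (q j) (q k)))).const_mul (Real.exp (-q i - max (q j) (q k)))
  have hI2 := fun i j k => (integrable_ite_Ico_exp β (q i) (min (q j) (q k))).const_mul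
    (Real.exp (q i - max (q j) (q k)))
  have hI3 := fun i j k => (integrable_ite_Ico_exp β (max (q j) (q k)) (q i)).const_mul
    (Real.exp (min (q j) (q k) - q i))
  have hI4 := fun i j k => (integrable_ite_le_exp (c := β - 2) (by linarith)
    (max (q i) (max (q j) (q k)))).const_mul (Real.exp (q i + min (q j) (q k)))
  have hI12 := fun i j k => (hI1 i j k).add (hI2 i j k)
  have hI123 := fun i j k => (hI12 i j k).add (hI3 i j k)
  have hI := fun i j k => ((hI123 i j k).add (hI4 i j k)).const_mul (p i * p j * p k)
  simp only [Pi.add_def] at hI12 hI123 hI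
  simp only [multipeakon_mul_energySource_mul_exp]
  rw [integral_finsetSum _ fun i _ => integrable_finsetSum _ fun j _ =>
    integrable_finsetSum _ fun k _ => hI i j k, Finset.mul_sum]
  refine Finset.sum_congr rfl fun i _ => ?_
  rw [integral_finsetSum _ fun j _ => integrable_finsetSum _ fun k _ => hI i j k, Finset.mul_sum]
  refine Finset.sum_congr rfl fun j _ => ?_
  rw [integral_finsetSum _ fun k _ => hI i j k, Finset.mul_sum]
  refine Finset.sum_congr rfl fun k _ => ?_
  rw [integral_const_mul, integral_add (hI123 i j k) (hI4 i j k),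
    integral_add (hI12 i j k) (hI3 i j k), integral_add (hI1 i j k) (hI2 i j k),
    integral_const_mul, integral_const_mul, integral_const_mul, integral_const_mul,
    integral_ite_lt_exp (by linarith), integral_ite_le_exp (by linarith), fluxKernel,
    ← mul_integral_ite_Ico_exp β (q i), ← mul_integral_ite_Ico_exp β (max (q j) (q k)),
    neg_div, ← div_neg, neg_sub]
  ring

/-- Nonnegativity of the source lets `|u| ≤ √E` be pulled out of the integral; what remains is
`integral_energySource_le`. The factor `|β|` is bounded by `1`. -/
theorem abs_integral_multipeakon_mul_energySource_le {β : ℝ} (h : |β| < 1) (p q : Fin N → ℝ) :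
    |2 * β * ∫ x, multipeakon p q x * energySource p q x * Real.exp (β * x)| ≤
      2 * √(expEnergy 0 p q) * (3 / (2 * (1 - |β|))) * expEnergy β p q := by
  have hu : ∀ x, |multipeakon p q x| ≤ √(expEnergy 0 p q) := fun x =>
    Real.abs_le_sqrt (by nlinarith [two_mul_multipeakon_sq_le p q x, sq_nonneg (multipeakon p q x)])
  have h1 : |∫ x, multipeakon p q x * energySource p q x * Real.exp (β * x)| ≤
      ∫ x, √(expEnergy 0 p q) * (energySource p q x * Real.exp (β * x)) := by
    rw [← Real.norm_eq_abs]
    refine norm_integral_le_of_norm_le ((integrable_energySource h p q).const_mul _)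
      (ae_of_all _ fun x => ?_)
    rw [mul_assoc, norm_mul, Real.norm_eq_abs, Real.norm_of_nonneg
      (mul_nonneg (energySource_nonneg p q x) (Real.exp_pos _).le)]
    exact mul_le_mul_of_nonneg_right (hu x)
      (mul_nonneg (energySource_nonneg p q x) (Real.exp_pos _).le)
  rw [integral_const_mul] at h1
  have h2 := mul_le_mul_of_nonneg_left (integral_energySource_le h p q)
    (Real.sqrt_nonneg (expEnergy 0 p q))
  rw [abs_mul, abs_mul, abs_two, mul_assoc, mul_assoc, mul_assoc]
  refine mul_le_mul_of_nonneg_left ?_ zero_le_two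
  calc _ ≤ 1 * |∫ x, multipeakon p q x * energySource p q x * Real.exp (β * x)| :=
        mul_le_mul_of_nonneg_right h.le (abs_nonneg _)
    _ ≤ _ := by linarith

/-! ### Time derivative of the weighted energy -/

/-- The derivative of `energyKernel β` in its first variable; on the diagonal, the average of the
two one-sided derivatives. -/
noncomputable def energyKernelDeriv (β a b : ℝ) : ℝ :=
  if a < b then 2 * (Real.exp (a - b) *
    ((1 + β) * Real.exp (β * a) / (2 + β) + Real.exp (β * b) / (2 - β)))
  else if b < a then 2 * (Real.exp (b - a) *
    (-Real.exp (β * b) / (2 + β) + (β - 1) * Real.exp (β * a) / (2 - β)))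
  else β * (Real.exp (β * a) / (2 + β) + Real.exp (β * a) / (2 - β))

theorem energyKernel_comm (β a b : ℝ) : energyKernel β a b = energyKernel β b a := by
  rw [energyKernel, energyKernel, min_comm, max_comm, add_comm a b]
  ring_nf

theorem energyKernel_of_le (β : ℝ) {a b : ℝ} (h : a ≤ b) : energyKernel β a b =
    2 * (Real.exp (a - b) * (Real.exp (β * a) / (2 + β) + Real.exp (β * b) / (2 - β))) := by
  have e1 : Real.exp (-a - b) * Real.exp ((2 + β) * a) = Real.exp (a - b) * Real.exp (β * a) := by
    rw [← Real.exp_add, ← Real.exp_add]; ring_nf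
  have e2 : Real.exp (a + b) * Real.exp ((β - 2) * b) = Real.exp (a - b) * Real.exp (β * b) := by
    rw [← Real.exp_add, ← Real.exp_add]; ring_nf
  rw [energyKernel, min_eq_left h, max_eq_right h]
  linear_combination 2 / (2 + β) * e1 + 2 / (2 - β) * e2

theorem hasDerivAt_energyKernel_of_lt (β : ℝ) {x y : ℝ → ℝ} {x' y' t : ℝ}
    (hx : HasDerivAt x x' t) (hy : HasDerivAt y y' t) (h : x t < y t) :
    HasDerivAt (fun s => energyKernel β (x s) (y s))
      (energyKernelDeriv β (x t) (y t) * x' + energyKernelDeriv β (y t) (x t) * y') t := by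
  have hev : (fun s => energyKernel β (x s) (y s)) =ᶠ[𝓝 t] fun s => 2 * (Real.exp (x s - y s) *
      (Real.exp (β * x s) / (2 + β) + Real.exp (β * y s) / (2 - β))) := by
    filter_upwards [hx.continuousAt.eventually_lt hy.continuousAt h] with s hs
    exact energyKernel_of_le β hs.le
  refine HasDerivAt.congr_of_eventuallyEq ?_ hev
  refine ((((hx.sub hy).exp).mul ((((hx.const_mul β).exp).div_const (2 + β)).add
    (((hy.const_mul β).exp).div_const (2 - β)))).const_mul 2).congr_deriv ?_
  rw [energyKernelDeriv, energyKernelDeriv, if_pos h, if_neg h.not_gt, if_pos h]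
  simp only [Pi.add_apply, Pi.sub_apply]
  ring

theorem hasDerivAt_energyKernel_self (β : ℝ) {x : ℝ → ℝ} {x' t : ℝ} (hx : HasDerivAt x x' t) :
    HasDerivAt (fun s => energyKernel β (x s) (x s))
      (energyKernelDeriv β (x t) (x t) * x' + energyKernelDeriv β (x t) (x t) * x') t := by
  simp only [energyKernel_of_le β le_rfl, sub_self, Real.exp_zero, one_mul]
  refine (((((hx.const_mul β).exp).div_const (2 + β)).add
    (((hx.const_mul β).exp).div_const (2 - β))).const_mul 2).congr_deriv ?_
  rw [energyKernelDeriv, if_neg (lt_irrefl _), if_neg (lt_irrefl _)]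
  ring

/-- The kernel of the cubic form which is the time derivative of the weighted energy. -/
noncomputable def energyRateKernel (β a b c : ℝ) : ℝ :=
  2 * Real.exp (-|a - c|) *
    (Real.sign (a - c) * energyKernel β a b + energyKernelDeriv β a b)

/-- The sum of a function of three variables over the permutations of its arguments. -/
def symmSum {X : Type*} (f : X → X → X → ℝ) (a b c : X) : ℝ :=
  f a b c + f a c b + f b a c + f b c a + f c a b + f c b a

theorem sum_symmSum {ι : Type*} [Fintype ι] (f : ι → ι → ι → ℝ) :
    ∑ i, ∑ j, ∑ k, symmSum f i j k = 6 * ∑ i, ∑ j, ∑ k, f i j k := by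
  have h1 : ∀ g : ι → ι → ι → ℝ, ∑ i, ∑ j, ∑ k, g i k j = ∑ i, ∑ j, ∑ k, g i j k := fun g =>
    Finset.sum_congr rfl fun i _ => Finset.sum_comm
  have h2 : ∀ g : ι → ι → ι → ℝ, ∑ i, ∑ j, ∑ k, g j i k = ∑ i, ∑ j, ∑ k, g i j k := fun g =>
    Finset.sum_comm
  have e1 := h1 f
  have e2 := h2 f
  have e3 := (h2 fun i j k => f i k j).trans (h1 f)
  have e4 := (h1 fun i j k => f j i k).trans (h2 f)
  have e5 := (h1 fun i j k => f j k i).trans e3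
  simp only [symmSum, Finset.sum_add_distrib]
  linarith

/-- For ordered arguments both sides are rational in `e^a`, `e^b`, `e^c`, `e^{βa}`, `e^{βb}`,
`e^{βc}`, so the identity is algebraic. Ties need their own cases, since index triples with
repetitions occur in the cubic sums and the sign and `energyKernelDeriv` jump there. -/
theorem symmSum_energyRateKernel_of_le {β : ℝ} (h : |β| < 2) {a b c : ℝ} (hab : a ≤ b)
    (hbc : b ≤ c) :
    symmSum (energyRateKernel β) a b c = symmSum (fluxKernel β) a b c := by
  obtain ⟨h1, h2⟩ := abs_lt.1 h
  have n1 : 2 + β ≠ 0 := by linarith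
  have n2 : 2 - β ≠ 0 := by linarith
  have hac := hab.trans hbc
  have e1 : ∀ x, Real.exp ((2 + β) * x) = Real.exp x * Real.exp x * Real.exp (β * x) := fun x => by
    rw [← Real.exp_add, ← Real.exp_add]; ring_nf
  have e2 : ∀ x, Real.exp ((β - 2) * x) = (Real.exp x)⁻¹ * (Real.exp x)⁻¹ * Real.exp (β * x) :=
    fun x => by rw [← Real.exp_neg, ← Real.exp_add, ← Real.exp_add]; ring_nf
  have a1 : |a - b| = b - a := by rw [abs_sub_comm, abs_of_nonneg (by linarith)]
  have a2 : |b - a| = b - a := abs_of_nonneg (by linarith)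
  have a3 : |b - c| = c - b := by rw [abs_sub_comm, abs_of_nonneg (by linarith)]
  have a4 : |c - b| = c - b := abs_of_nonneg (by linarith)
  have a5 : |a - c| = c - a := by rw [abs_sub_comm, abs_of_nonneg (by linarith)]
  have a6 : |c - a| = c - a := abs_of_nonneg (by linarith)
  have ha := (Real.exp_pos a).ne'
  have hb := (Real.exp_pos b).ne'
  have hc := (Real.exp_pos c).ne'
  simp only [symmSum, energyRateKernel, fluxKernel, energyKernel_comm β b a, energyKernel_comm β c a,
    energyKernel_comm β c b, energyKernel_of_le β hab, energyKernel_of_le β hbc,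
    energyKernel_of_le β hac, a1, a2, a3, a4, a5, a6, min_eq_left, min_eq_right,
    max_eq_left, max_eq_right, hab, hbc, hac, e1, e2]
  rcases hab.lt_or_eq with hab' | rfl <;> rcases hbc.lt_or_eq with hbc' | rfl
  · have hac' := hab'.trans hbc'
    simp only [energyKernelDeriv, if_pos hab', if_neg hab'.not_gt, if_pos hbc', if_neg hbc'.not_gt,
      if_pos hac', if_neg hac'.not_gt, Real.sign_of_neg (sub_neg.2 hab'),
      Real.sign_of_neg (sub_neg.2 hbc'), Real.sign_of_neg (sub_neg.2 hac'),
      Real.sign_of_pos (sub_pos.2 hab'), Real.sign_of_pos (sub_pos.2 hbc'),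
      Real.sign_of_pos (sub_pos.2 hac'), Real.exp_add, Real.exp_sub, Real.exp_neg]
    field_simp
    ring
  · simp only [energyKernelDeriv, if_pos hab', if_neg hab'.not_gt, lt_irrefl, if_false, sub_self,
      Real.sign_zero, Real.sign_of_neg (sub_neg.2 hab'), Real.sign_of_pos (sub_pos.2 hab'),
      Real.exp_add, Real.exp_sub, Real.exp_neg, Real.exp_zero]
    field_simp
    ring
  · simp only [energyKernelDeriv, if_pos hbc', if_neg hbc'.not_gt, lt_irrefl, if_false, sub_self,
      Real.sign_zero, Real.sign_of_neg (sub_neg.2 hbc'), Real.sign_of_pos (sub_pos.2 hbc'),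
      Real.exp_add, Real.exp_sub, Real.exp_neg, Real.exp_zero]
    field_simp
    ring
  · simp only [energyKernelDeriv, lt_irrefl, if_false, sub_self,
      Real.sign_zero, Real.exp_add, Real.exp_sub, Real.exp_neg, Real.exp_zero]
    field_simp
    ring

theorem symmSum_energyRateKernel {β : ℝ} (h : |β| < 2) (a b c : ℝ) :
    symmSum (energyRateKernel β) a b c = symmSum (fluxKernel β) a b c := by
  have key := @symmSum_energyRateKernel_of_le β h
  have swap1 : ∀ (f : ℝ → ℝ → ℝ → ℝ) a b c, symmSum f a c b = symmSum f a b c := fun f a b c => by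
    simp only [symmSum]; ring
  have swap2 : ∀ (f : ℝ → ℝ → ℝ → ℝ) a b c, symmSum f b a c = symmSum f a b c := fun f a b c => by
    simp only [symmSum]; ring
  rcases le_total a b with h1 | h1 <;> rcases le_total b c with h2 | h2 <;>
    rcases le_total a c with h3 | h3
  · exact key h1 h2
  · exact key h1 h2
  · rw [← swap1 _ a b c, ← swap1 _ a b c]; exact key h3 h2
  · rw [← swap1 _ a b c, ← swap1 _ a b c, ← swap2, ← swap2 _ a c b]; exact key h3 h1
  · rw [← swap2, ← swap2 _ a b c]; exact key h1 h3
  · rw [← swap2, ← swap2 _ a b c, ← swap1, ← swap1 _ b a c]; exact key h2 h3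
  · rw [← swap2, ← swap2 _ a b c, ← swap1, ← swap1 _ b a c, ← swap2, ← swap2 _ b c a]
    exact key h2 h1
  · rw [← swap2, ← swap2 _ a b c, ← swap1, ← swap1 _ b a c, ← swap2, ← swap2 _ b c a]
    exact key h2 h1

/-- The product of three strengths is symmetric, so a cubic form sees only the symmetrized kernel;
the kernels themselves need not agree. -/
theorem sum_energyRateKernel {β : ℝ} (h : |β| < 2) (p q : Fin N → ℝ) :
    ∑ i, ∑ j, ∑ k, p i * p j * p k * energyRateKernel β (q i) (q j) (q k) =
      ∑ i, ∑ j, ∑ k, p i * p j * p k * fluxKernel β (q i) (q j) (q k) := by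
  have h6 : (6 : ℝ) ≠ 0 := by norm_num
  rw [← mul_right_inj' h6,
    ← sum_symmSum fun i j k => p i * p j * p k * energyRateKernel β (q i) (q j) (q k),
    ← sum_symmSum fun i j k => p i * p j * p k * fluxKernel β (q i) (q j) (q k)]
  refine Finset.sum_congr rfl fun i _ => Finset.sum_congr rfl fun j _ =>
    Finset.sum_congr rfl fun k _ => ?_
  have := symmSum_energyRateKernel h (q i) (q j) (q k)
  simp only [symmSum] at this ⊢
  linear_combination p i * p j * p k * this

theorem hasDerivAt_expEnergy {β : ℝ} (h : |β| < 2) {p q : ℝ → Fin N → ℝ} {t : ℝ}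
    (hq : Function.Injective (q t))
    (hqd : ∀ i, HasDerivAt (fun s => q s i) (∑ j, p t j * Real.exp (-|q t i - q t j|)) t)
    (hpd : ∀ i, HasDerivAt (fun s => p s i)
      (p t i * ∑ j, p t j * Real.sign (q t i - q t j) * Real.exp (-|q t i - q t j|)) t) :
    HasDerivAt (fun s => expEnergy β (p s) (q s)) (2 * β * ∫ x, multipeakon (p t) (q t) x *
      energySource (p t) (q t) x * Real.exp (β * x)) t := by
  simp only [expEnergy_eq_sum h]
  rw [integral_multipeakon_mul_energySource h, ← sum_energyRateKernel h]
  have hG : ∀ i j, HasDerivAt (fun s => energyKernel β (q s i) (q s j))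
      (energyKernelDeriv β (q t i) (q t j) * (∑ k, p t k * Real.exp (-|q t i - q t k|)) +
        energyKernelDeriv β (q t j) (q t i) * ∑ k, p t k * Real.exp (-|q t j - q t k|)) t := by
    intro i j
    rcases lt_trichotomy (q t i) (q t j) with hij | hij | hij
    · exact hasDerivAt_energyKernel_of_lt β (hqd i) (hqd j) hij
    · obtain rfl := hq hij
      exact hasDerivAt_energyKernel_self β (hqd i)
    · simp only [energyKernel_comm β (q _ i)]
      rw [add_comm]
      exact hasDerivAt_energyKernel_of_lt β (hqd j) (hqd i) hij
  have hsum := HasDerivAt.fun_sum (u := Finset.univ) fun i _ =>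
    HasDerivAt.fun_sum (u := Finset.univ) fun j _ => ((hpd i).mul (hpd j)).mul (hG i j)
  refine hsum.congr_deriv ?_
  -- `T i j` collects the change of the pair term due to the first index. The second index
  -- contributes `T j i`, so after summation the derivative is `2 ∑ T`.
  set T : Fin N → Fin N → ℝ := fun i j =>
    p t i * p t j * ((∑ k, p t k * Real.sign (q t i - q t k) * Real.exp (-|q t i - q t k|)) *
      energyKernel β (q t i) (q t j) +
      energyKernelDeriv β (q t i) (q t j) * ∑ k, p t k * Real.exp (-|q t i - q t k|)) with hT
  have h1 : ∀ i j, ∑ k, p t i * p t j * p t k * energyRateKernel β (q t i) (q t j) (q t k) =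
      2 * T i j := by
    intro i j
    simp only [hT, Finset.sum_mul, Finset.mul_sum, ← Finset.sum_add_distrib, energyRateKernel]
    exact Finset.sum_congr rfl fun k _ => by ring
  have h2 : ∑ i, ∑ j, T i j = ∑ i, ∑ j, T j i := Finset.sum_comm
  simp only [h1, ← Finset.mul_sum]
  rw [two_mul]
  conv_rhs => arg 2; rw [h2]
  simp only [← Finset.sum_add_distrib]
  refine Finset.sum_congr rfl fun i _ => Finset.sum_congr rfl fun j _ => ?_
  simp only [hT, Pi.mul_apply, energyKernel_comm β (q t j) (q t i)]
  ring

/-! ### Moments of a cluster of peakons -/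

/-- Reflection invariance transfers results on the moments with `e^{-q_j}` to those with `e^{q_j}`.
-/
theorem expEnergy_zero_neg (p q : Fin N → ℝ) :
    expEnergy 0 p (fun i => -q i) = expEnergy 0 p q := by
  simp only [expEnergy_eq_sum (show |(0 : ℝ)| < 2 by norm_num), energyKernel_zero]
  refine Finset.sum_congr rfl fun i _ => Finset.sum_congr rfl fun j _ => ?_
  rw [← abs_neg (q i - q j)]
  ring_nf

theorem integrable_expCoeff_sq_mul (p q : Fin N → ℝ) :
    Integrable fun x => expCoeff p q x ^ 2 * Real.exp (2 * x) := by
  simpa using integrable_expCoeff_sq (β := 0) (by norm_num) p q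

theorem two_mul_integral_expCoeff_sq_le (p q : Fin N → ℝ) :
    2 * (∫ x, expCoeff p q x ^ 2 * Real.exp (2 * x)) ≤ expEnergy 0 p q := by
  have h := expEnergy_eq_add (β := 0) (by norm_num) p q
  have h0 : (0 : ℝ) ≤ ∫ x, expNegCoeff p q x ^ 2 * Real.exp (-(2 * x)) * Real.exp (0 * x) :=
    integral_nonneg fun x => by positivity
  simp only [zero_mul, Real.exp_zero, mul_one] at h h0
  linarith

/-- On a peakon-free interval the coefficient is constant, so bounded energy bounds it, however
large the individual strengths are. -/
theorem sq_mul_le_of_expCoeff_eq (p q : Fin N → ℝ) {a u v : ℝ} (huv : u ≤ v)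
    (h : ∀ y ∈ Set.Ioo u v, expCoeff p q y = a) :
    2 * (a ^ 2 * Real.exp (2 * u) * (v - u)) ≤ expEnergy 0 p q := by
  refine le_trans (mul_le_mul_of_nonneg_left ?_ zero_le_two) (two_mul_integral_expCoeff_sq_le p q)
  have h1 : ∫ y in Set.Ioo u v, a ^ 2 * Real.exp (2 * u) ≤
      ∫ y in Set.Ioo u v, expCoeff p q y ^ 2 * Real.exp (2 * y) := by
    refine setIntegral_mono_on (integrableOn_const (by simp)) (integrable_expCoeff_sq_mul p q).integrableOn
      measurableSet_Ioo fun y hy => ?_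
    rw [h y hy]
    have := hy.1
    gcongr
  have h2 : ∫ y in Set.Ioo u v, expCoeff p q y ^ 2 * Real.exp (2 * y) ≤
      ∫ y, expCoeff p q y ^ 2 * Real.exp (2 * y) :=
    setIntegral_le_integral (integrable_expCoeff_sq_mul p q) (ae_of_all _ fun y => by positivity)
  rw [setIntegral_const] at h1
  simp only [Measure.real, Real.volume_Ioo, ENNReal.toReal_ofReal (sub_nonneg.2 huv),
    smul_eq_mul] at h1
  linarith

theorem integral_ite_lt_mul_deriv {θ θ' : ℝ → ℝ} (hθ : ∀ y, HasDerivAt θ (θ' y) y)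
    (hθ' : Continuous θ') {x₀ x₁ : ℝ} (hx : x₀ ≤ x₁) (m c : ℝ) :
    IntervalIntegrable (fun y => (if y < m then c else 0) * θ' y) volume x₀ x₁ ∧
    ∫ y in x₀..x₁, (if y < m then c else 0) * θ' y =
      if x₀ ≤ m then c * (θ (min x₁ m) - θ x₀) else 0 := by
  have hfun : (fun y => (if y < m then c else 0) * θ' y) =
      fun y => c * (Set.Iio m).indicator θ' y := by
    ext y; by_cases hy : y < m <;> simp [hy]
  have hfun' : (fun y => (Set.Iio m).indicator θ' y) =ᵐ[volume.restrict (Set.Ioc x₀ x₁)]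
      (Set.Iic m).indicator θ' := ae_restrict_of_ae (indicator_ae_eq_of_ae_eq_set Iio_ae_eq_Iic)
  rw [hfun]
  constructor
  · rw [intervalIntegrable_iff_integrableOn_Ioc_of_le hx]
    exact (Integrable.indicator ((intervalIntegrable_iff_integrableOn_Ioc_of_le hx).1
      (hθ'.intervalIntegrable x₀ x₁)) measurableSet_Iio).const_mul c
  · rw [intervalIntegral.integral_const_mul, intervalIntegral.integral_of_le hx,
      integral_congr_ae hfun', setIntegral_indicator measurableSet_Iic, Set.Ioc_inter_Iic]
    split_ifs with h
    · rw [← intervalIntegral.integral_of_le (le_min hx h),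
        intervalIntegral.integral_eq_sub_of_hasDerivAt (fun y _ => hθ y)
          (hθ'.intervalIntegrable _ _)]
    · rw [Set.Ioc_eq_empty_of_le ((min_le_right _ _).trans (not_le.1 h).le)]
      simp

/-- Summation by parts against the step function `expCoeff p q`. -/
theorem sum_ite_mul_eq_integral_expCoeff (p q : Fin N → ℝ) {θ θ' : ℝ → ℝ}
    (hθ : ∀ y, HasDerivAt θ (θ' y) y) (hθ' : Continuous θ') {x₀ x₁ : ℝ} (hx : x₀ ≤ x₁) :
    (∑ j, if x₀ < q j ∧ q j ≤ x₁ then p j * Real.exp (-q j) * θ (q j) else 0) =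
      θ x₀ * expCoeff p q x₀ - θ x₁ * expCoeff p q x₁ +
        ∫ y in x₀..x₁, expCoeff p q y * θ' y := by
  simp only [expCoeff, Finset.sum_mul]
  rw [intervalIntegral.integral_finsetSum fun j _ =>
    (integral_ite_lt_mul_deriv hθ hθ' hx (q j) (p j * Real.exp (-q j))).1]
  simp only [Finset.mul_sum, ← Finset.sum_sub_distrib, ← Finset.sum_add_distrib]
  refine Finset.sum_congr rfl fun j _ => ?_
  rw [(integral_ite_lt_mul_deriv hθ hθ' hx (q j) (p j * Real.exp (-q j))).2]
  rcases lt_trichotomy x₀ (q j) with h | h | h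
  · rcases lt_or_ge x₁ (q j) with h' | h'
    · rw [if_neg (fun hh => hh.2.not_gt h'), if_pos h, if_pos h', if_pos h.le, min_eq_left h'.le]
      ring
    · rw [if_pos ⟨h, h'⟩, if_pos h, if_neg h'.not_gt, if_pos h.le, min_eq_right h']
      ring
  · rw [if_neg (fun hh => hh.1.ne h), if_neg h.not_lt, if_neg (h.symm.le.trans hx).not_gt,
      if_pos h.le, min_eq_right (h.symm.le.trans hx), h]
    ring
  · rw [if_neg (fun hh => hh.1.not_gt h), if_neg h.not_gt, if_neg (h.le.trans hx).not_gt,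
      if_neg h.not_ge]
    ring

/-- Young's inequality `s ≤ √δ s²/2 + 1/(2√δ)` with `s = |A| e^y`: the square is controlled by the
energy, and the constant is integrated over an interval of length `2δ`, so both terms are of order
`√δ`. -/
theorem abs_integral_expCoeff_mul_exp_le (p q : Fin N → ℝ) {M δ z : ℝ} (hδ : 0 < δ)
    (hM : expEnergy 0 p q ≤ M) :
    |∫ y in (z - δ)..(z + δ), expCoeff p q y * (-Real.exp (y - z))| ≤
      √δ * (Real.exp (-z) * (M / 4 + 1)) := by
  have hs : 0 < √δ := Real.sqrt_pos.2 hδ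
  have hss : √δ * √δ = δ := Real.mul_self_sqrt hδ.le
  have hle : z - δ ≤ z + δ := by linarith
  have hI := (integrable_expCoeff_sq_mul p q).const_mul (√δ / 2 * Real.exp (-z))
  have hb : ∀ y, ‖expCoeff p q y * (-Real.exp (y - z))‖ ≤
      √δ / 2 * Real.exp (-z) * (expCoeff p q y ^ 2 * Real.exp (2 * y)) +
        Real.exp (-z) / (2 * √δ) := by
    intro y
    have e1 : Real.exp (2 * y) = Real.exp y ^ 2 := by rw [← Real.exp_nat_mul]; norm_num
    rw [norm_mul, norm_neg, Real.norm_eq_abs, Real.norm_of_nonneg (Real.exp_pos _).le,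
      sub_eq_add_neg, Real.exp_add, e1, ← sq_abs (expCoeff p q y)]
    have h2 : 0 ≤ (√δ * (|expCoeff p q y| * Real.exp y) - 1) ^ 2 := sq_nonneg _
    have h3 : |expCoeff p q y| * Real.exp y ≤
        √δ / 2 * (|expCoeff p q y| * Real.exp y) ^ 2 + 1 / (2 * √δ) := by
      rw [← sub_nonneg]
      have : √δ / 2 * (|expCoeff p q y| * Real.exp y) ^ 2 + 1 / (2 * √δ) -
          |expCoeff p q y| * Real.exp y =
          (√δ * (|expCoeff p q y| * Real.exp y) - 1) ^ 2 / (2 * √δ) := by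
        field_simp; ring
      rw [this]; positivity
    calc _ = (|expCoeff p q y| * Real.exp y) * Real.exp (-z) := by ring
      _ ≤ _ := mul_le_mul_of_nonneg_right h3 (Real.exp_pos _).le
      _ = _ := by ring
  have h1 := intervalIntegral.norm_integral_le_of_norm_le hle (ae_of_all _ fun y _ => hb y)
    (hI.intervalIntegrable.add intervalIntegrable_const)
  rw [Real.norm_eq_abs, intervalIntegral.integral_add hI.intervalIntegrable
    intervalIntegrable_const, intervalIntegral.integral_const,
    intervalIntegral.integral_const_mul] at h1
  have h2 : ∫ y in (z - δ)..(z + δ), expCoeff p q y ^ 2 * Real.exp (2 * y) ≤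
      ∫ y, expCoeff p q y ^ 2 * Real.exp (2 * y) := by
    rw [intervalIntegral.integral_of_le hle]
    exact setIntegral_le_integral (integrable_expCoeff_sq_mul p q) (ae_of_all _ fun y => by positivity)
  have h3 := two_mul_integral_expCoeff_sq_le p q
  have h4 : (z + δ - (z - δ)) • (Real.exp (-z) / (2 * √δ)) = √δ * Real.exp (-z) := by
    rw [smul_eq_mul]
    field_simp
    linear_combination -2 * hss
  rw [h4] at h1
  have h5 : ∫ y in (z - δ)..(z + δ), expCoeff p q y ^ 2 * Real.exp (2 * y) ≤ M / 2 := by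
    linarith
  have h6 := mul_le_mul_of_nonneg_left h5
    (show 0 ≤ √δ / 2 * Real.exp (-z) by positivity)
  linarith

/-- Summation by parts with `θ(y) = 1 - e^{y-z}` avoids the possibly huge single strengths. In the
boundary terms `θ = O(δ)`, while the coefficient is bounded through the peakon-free collars between
distance `δ` and `r` from `z`; the remaining integral is `O(√δ)`. -/
theorem abs_sum_cluster_exp_sub_le (p q : Fin N → ℝ) {M δ r z : ℝ} (hδ : 0 < δ)
    (hr : r ≤ 1) (hδr : 2 * δ ≤ r) (hM : expEnergy 0 p q ≤ M)
    (hq : ∀ j, |q j - z| < δ ∨ r ≤ |q j - z|) :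
    |∑ j, if |q j - z| < δ then p j * (Real.exp (-q j) - Real.exp (-z)) else 0| ≤
      √δ * (Real.exp (-z) * (M / 4 + 1)) + 3 * δ * √(M * Real.exp (2 * (r - z)) / r) := by
  have hr0 : 0 < r := by linarith
  have hθ : ∀ y, HasDerivAt (fun y => 1 - Real.exp (y - z)) (-Real.exp (y - z)) y := fun y => by
    simpa using (((hasDerivAt_id y).sub_const z).exp).const_sub 1
  have hsum := sum_ite_mul_eq_integral_expCoeff p q hθ (by fun_prop)
    (show z - δ ≤ z + δ by linarith)
  have hcongr : (∑ j, if |q j - z| < δ then p j * (Real.exp (-q j) - Real.exp (-z)) else 0) =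
      ∑ j, if z - δ < q j ∧ q j ≤ z + δ then
        p j * Real.exp (-q j) * (1 - Real.exp (q j - z)) else 0 := by
    refine Finset.sum_congr rfl fun j _ => ?_
    have e : Real.exp (-q j) * Real.exp (q j - z) = Real.exp (-z) := by
      rw [← Real.exp_add]; ring_nf
    have hiff : |q j - z| < δ ↔ z - δ < q j ∧ q j ≤ z + δ := by
      refine ⟨fun h => ?_, fun h => ?_⟩
      · have := abs_lt.1 h
        constructor <;> linarith
      · rcases hq j with h' | h'
        · exact h'
        · have : |q j - z| ≤ δ := abs_le.2 ⟨by linarith, by linarith⟩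
          linarith
    simp only [hiff]
    split_ifs
    · linear_combination p j * e
    · rfl
  have hbound : ∀ {a u v : ℝ}, z - r ≤ u → u + r / 2 ≤ v →
      (∀ y ∈ Set.Ioo u v, expCoeff p q y = a) → |a| ≤ √(M * Real.exp (2 * (r - z)) / r) := by
    intro a u v hu huv h
    refine Real.abs_le_sqrt ?_
    have h1 := sq_mul_le_of_expCoeff_eq p q (by linarith) h
    have h2 : a ^ 2 * Real.exp (2 * (z - r)) * (r / 2) ≤ a ^ 2 * Real.exp (2 * u) * (v - u) := by
      have : r / 2 ≤ v - u := by linarith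
      gcongr
    have h3 : Real.exp (2 * (r - z)) = (Real.exp (2 * (z - r)))⁻¹ := by
      rw [← Real.exp_neg]; ring_nf
    rw [h3, le_div_iff₀ hr0, ← div_eq_mul_inv, le_div_iff₀ (Real.exp_pos _)]
    linarith
  have hA0 : |expCoeff p q (z - δ)| ≤ √(M * Real.exp (2 * (r - z)) / r) := by
    refine hbound (u := z - r) (v := z - δ) le_rfl (by linarith) fun y hy => ?_
    refine Finset.sum_congr rfl fun j _ => ?_
    have : y < q j ↔ z - δ < q j := by
      refine ⟨fun h => ?_, fun h => hy.2.trans h⟩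
      rcases hq j with h' | h'
      · linarith [(abs_lt.1 h').1]
      · rcases le_abs.1 h' with h'' | h'' <;> linarith [hy.1]
    simp only [this]
  have hA1 : |expCoeff p q (z + δ)| ≤ √(M * Real.exp (2 * (r - z)) / r) := by
    refine hbound (u := z + δ) (v := z + r) (by linarith) (by linarith) fun y hy => ?_
    refine Finset.sum_congr rfl fun j _ => ?_
    have : y < q j ↔ z + δ < q j := by
      refine ⟨fun h => hy.1.trans h, fun h => ?_⟩
      rcases hq j with h' | h'
      · linarith [(abs_lt.1 h').2]
      · rcases le_abs.1 h' with h'' | h'' <;> linarith [hy.2]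
    simp only [this]
  have hθ0 : |1 - Real.exp (z - δ - z)| ≤ δ := by
    have e : z - δ - z = -δ := by ring
    have := Real.add_one_le_exp (-δ)
    rw [e, abs_of_nonneg (by linarith [Real.exp_le_one_iff.2 (neg_nonpos.2 hδ.le)])]
    linarith
  have hθ1 : |1 - Real.exp (z + δ - z)| ≤ 2 * δ := by
    have e : z + δ - z = δ := by ring
    rw [e, abs_sub_comm]
    have := Real.abs_exp_sub_one_le (x := δ) (by rw [abs_of_pos hδ]; linarith)
    rwa [abs_of_pos hδ] at this
  rw [hcongr, hsum]
  have hI := abs_integral_expCoeff_mul_exp_le p q (z := z) hδ hM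
  have h1 := mul_le_mul hθ0 hA0 (abs_nonneg _) hδ.le
  have h2 := mul_le_mul hθ1 hA1 (abs_nonneg _) (by linarith)
  rw [← abs_mul] at h1 h2
  refine (abs_add_le _ _).trans ?_
  have h3 := abs_sub ((1 - Real.exp (z - δ - z)) * expCoeff p q (z - δ))
    ((1 - Real.exp (z + δ - z)) * expCoeff p q (z + δ))
  linarith

theorem tendsto_sum_cluster_exp_sub {p q : ℝ → Fin N → ℝ} {Q : Fin N → ℝ} {τ M : ℝ}
    (hq : ∀ j, Tendsto (fun t => q t j) (𝓝[≠] τ) (𝓝 (Q j)))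
    (hM : ∀ᶠ t in 𝓝[≠] τ, expEnergy 0 (p t) (q t) ≤ M) (z : ℝ) :
    Tendsto (fun t => ∑ j, if Q j = z then p t j * (Real.exp (-q t j) - Real.exp (-z)) else 0)
      (𝓝[≠] τ) (𝓝 0) := by
  -- The limit positions are separated by `2r`, so that peakons of other clusters stay at distance
  -- at least `r` after a displacement below `r/2`.
  obtain ⟨r, hr0, hr1, hr⟩ : ∃ r : ℝ, 0 < r ∧ r ≤ 1 ∧ ∀ j, Q j = z ∨ 2 * r ≤ |Q j - z| := by
    have h1 : ∀ᶠ r : ℝ in 𝓝[>] 0, ∀ j, Q j = z ∨ 2 * r ≤ |Q j - z| := by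
      rw [eventually_all]
      intro j
      by_cases hj : Q j = z
      · exact Eventually.of_forall fun _ => Or.inl hj
      · have : 0 < |Q j - z| / 2 := by have := abs_pos.2 (sub_ne_zero.2 hj); linarith
        filter_upwards [nhdsWithin_le_nhds (Iio_mem_nhds this)] with r hr
        right
        have := Set.mem_Iio.1 hr
        linarith
    have h2 : ∀ᶠ r : ℝ in 𝓝[>] 0, r ≤ 1 := nhdsWithin_le_nhds (Iic_mem_nhds one_pos)
    obtain ⟨r, h⟩ := (h1.and (h2.and self_mem_nhdsWithin)).exists
    exact ⟨r, h.2.2, h.2.1, h.1⟩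
  -- The term `|t - τ|` makes `δ t` positive and strictly larger than every displacement.
  set δ : ℝ → ℝ := fun t => |t - τ| + ∑ j, |q t j - Q j| with hδ
  have hδ0 : Tendsto δ (𝓝[≠] τ) (𝓝 0) := by
    have h1 : Tendsto (fun t => |t - τ|) (𝓝[≠] τ) (𝓝 0) := by
      have : ContinuousAt (fun t => |t - τ|) τ := by fun_prop
      simpa using this.tendsto.mono_left nhdsWithin_le_nhds
    have h2 : Tendsto (fun t => ∑ j, |q t j - Q j|) (𝓝[≠] τ) (𝓝 0) := by
      simpa using tendsto_finsetSum (Finset.univ : Finset (Fin N))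
        fun j _ => ((hq j).sub_const (Q j)).abs
    simpa using h1.add h2
  have hlim : Tendsto (fun t => √(δ t) * (Real.exp (-z) * (M / 4 + 1)) +
      3 * δ t * √(M * Real.exp (2 * (r - z)) / r)) (𝓝[≠] τ) (𝓝 0) := by
    have h1 := (hδ0.sqrt.mul_const (Real.exp (-z) * (M / 4 + 1))).add
      ((hδ0.const_mul 3).mul_const √(M * Real.exp (2 * (r - z)) / r))
    simpa using h1
  refine squeeze_zero_norm' ?_ hlim
  have hsmall : ∀ᶠ t in 𝓝[≠] τ, δ t < r / 2 := hδ0.eventually_lt_const (by linarith)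
  filter_upwards [hsmall, hM, self_mem_nhdsWithin] with t ht hMt hne
  have hpos : 0 < |t - τ| := abs_pos.2 (sub_ne_zero.2 hne)
  have hle : ∀ j, |q t j - Q j| < δ t := fun j => by
    have := Finset.single_le_sum (f := fun j => |q t j - Q j|) (fun j _ => abs_nonneg _)
      (Finset.mem_univ j)
    simp only [hδ]
    linarith
  have hδt : 0 < δ t := by
    have : 0 ≤ ∑ j, |q t j - Q j| := Finset.sum_nonneg fun j _ => abs_nonneg _
    simp only [hδ]
    linarith
  have hfar : ∀ j, Q j ≠ z → r ≤ |q t j - z| := fun j hj => by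
    have h1 := (hr j).resolve_left hj
    have h2 := abs_sub_abs_le_abs_sub (Q j - z) (q t j - z)
    have h3 : |Q j - z - (q t j - z)| = |q t j - Q j| := by rw [abs_sub_comm]; congr 1; ring
    have := hle j
    linarith
  have hiff : ∀ j, Q j = z ↔ |q t j - z| < δ t := fun j => by
    refine ⟨fun h => h ▸ hle j, fun h => ?_⟩
    by_contra hj
    have := hfar j hj
    linarith
  simp only [hiff, Real.norm_eq_abs]
  refine abs_sum_cluster_exp_sub_le (p t) (q t) hδt hr1 (by linarith) hMt fun j => ?_
  by_cases hj : Q j = z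
  · exact Or.inl ((hiff j).1 hj)
  · exact Or.inr (hfar j hj)

/-! ### The weighted energy near an interaction time -/

theorem tendsto_sum_cluster_exp {p q : ℝ → Fin N → ℝ} {P Q : Fin N → ℝ} {τ M : ℝ}
    (hq : ∀ j, Tendsto (fun t => q t j) (𝓝[≠] τ) (𝓝 (Q j)))
    (hM : ∀ᶠ t in 𝓝[≠] τ, expEnergy 0 (p t) (q t) ≤ M) {z : ℝ}
    (hP : Tendsto (fun t => ∑ j with Q j = z, p t j) (𝓝[≠] τ) (𝓝 (∑ j with Q j = z, P j))) :
    Tendsto (fun t => ∑ j with Q j = z, p t j * Real.exp (-q t j)) (𝓝[≠] τ)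
      (𝓝 (∑ j with Q j = z, P j * Real.exp (-Q j))) := by
  have h := (tendsto_sum_cluster_exp_sub hq hM z).add (hP.mul_const (Real.exp (-z)))
  rw [zero_add] at h
  convert h using 2 with t
  · rw [Finset.sum_mul, ← Finset.sum_filter, ← Finset.sum_add_distrib]
    exact Finset.sum_congr rfl fun j _ => by ring
  · rw [Finset.sum_mul]
    exact Finset.sum_congr rfl fun j hj => by rw [(Finset.mem_filter.1 hj).2]

theorem tendsto_sum_cluster_exp_neg {p q : ℝ → Fin N → ℝ} {P Q : Fin N → ℝ} {τ M : ℝ}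
    (hq : ∀ j, Tendsto (fun t => q t j) (𝓝[≠] τ) (𝓝 (Q j)))
    (hM : ∀ᶠ t in 𝓝[≠] τ, expEnergy 0 (p t) (q t) ≤ M) {z : ℝ}
    (hP : Tendsto (fun t => ∑ j with Q j = z, p t j) (𝓝[≠] τ) (𝓝 (∑ j with Q j = z, P j))) :
    Tendsto (fun t => ∑ j with Q j = z, p t j * Real.exp (q t j)) (𝓝[≠] τ)
      (𝓝 (∑ j with Q j = z, P j * Real.exp (Q j))) := by
  have h := tendsto_sum_cluster_exp (p := p) (q := fun t j => -q t j) (P := P)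
    (Q := fun j => -Q j) (M := M) (z := -z) (fun j => (hq j).neg)
    (by simpa only [expEnergy_zero_neg] using hM) (by simpa only [neg_inj] using hP)
  simpa only [neg_inj, neg_neg] using h

/-- A step function is the sum of its jumps, grouped by the limit positions. -/
theorem sum_ite_eq_sum_fiber (Q c : Fin N → ℝ) (s : Fin N → Prop) [DecidablePred s] :
    (∑ j, if s j then c j else 0) =
      ∑ z ∈ Finset.univ.image Q, ∑ j with Q j = z, if s j then c j else 0 :=
  (Finset.sum_fiberwise_of_maps_to (fun j _ => Finset.mem_image_of_mem Q (Finset.mem_univ j))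
    _).symm

/-- Near the limit each cluster lies wholly on one side of `x`, so the coefficient is the sum of the
full moments of the clusters on the right. -/
theorem tendsto_expCoeff {p q : ℝ → Fin N → ℝ} {P Q : Fin N → ℝ} {l : Filter ℝ}
    (hq : ∀ j, Tendsto (fun t => q t j) l (𝓝 (Q j)))
    (hc : ∀ z, Tendsto (fun t => ∑ j with Q j = z, p t j * Real.exp (-q t j)) l
      (𝓝 (∑ j with Q j = z, P j * Real.exp (-Q j)))) {x : ℝ} (hx : ∀ j, x ≠ Q j) :
    Tendsto (fun t => expCoeff (p t) (q t) x) l (𝓝 (expCoeff P Q x)) := by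
  have hev : ∀ᶠ t in l, ∀ j, x < q t j ↔ x < Q j := by
    rw [eventually_all]
    intro j
    rcases lt_or_gt_of_ne (hx j) with h | h
    · filter_upwards [(hq j).eventually_const_lt h] with t ht using iff_of_true ht h
    · filter_upwards [(hq j).eventually_lt_const h] with t ht using iff_of_false ht.not_gt h.not_gt
  have key : ∀ c : Fin N → ℝ, (∑ j, if x < Q j then c j else 0) =
      ∑ z ∈ Finset.univ.image Q, if x < z then ∑ j with Q j = z, c j else 0 := by
    intro c
    rw [sum_ite_eq_sum_fiber Q]
    refine Finset.sum_congr rfl fun z _ => ?_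
    rw [Finset.sum_congr rfl (g := fun j => if x < z then c j else 0)
      fun j hj => by rw [(Finset.mem_filter.1 hj).2]]
    split_ifs <;> simp
  have hlim : Tendsto (fun t => ∑ z ∈ Finset.univ.image Q,
      if x < z then ∑ j with Q j = z, p t j * Real.exp (-q t j) else 0) l
      (𝓝 (∑ z ∈ Finset.univ.image Q,
        if x < z then ∑ j with Q j = z, P j * Real.exp (-Q j) else 0)) := by
    refine tendsto_finsetSum _ fun z _ => ?_
    split_ifs
    · exact hc z
    · exact tendsto_const_nhds
  rw [expCoeff, key]
  refine hlim.congr' ?_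
  filter_upwards [hev] with t ht
  simp only [expCoeff, ht, key]

theorem tendsto_expNegCoeff {p q : ℝ → Fin N → ℝ} {P Q : Fin N → ℝ} {l : Filter ℝ}
    (hq : ∀ j, Tendsto (fun t => q t j) l (𝓝 (Q j)))
    (hc : ∀ z, Tendsto (fun t => ∑ j with Q j = z, p t j * Real.exp (q t j)) l
      (𝓝 (∑ j with Q j = z, P j * Real.exp (Q j)))) {x : ℝ} (hx : ∀ j, x ≠ Q j) :
    Tendsto (fun t => expNegCoeff (p t) (q t) x) l (𝓝 (expNegCoeff P Q x)) := by
  have hrefl : ∀ (a b : Fin N → ℝ), (∀ j, x ≠ b j) →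
      expNegCoeff a b x = expCoeff a (fun j => -b j) (-x) := by
    intro a b hb
    refine Finset.sum_congr rfl fun j _ => ?_
    simp only [neg_lt_neg_iff, neg_neg, (hb j).symm.le_iff_lt]
  have hne : ∀ᶠ t in l, ∀ j, x ≠ q t j := by
    rw [eventually_all]
    exact fun j => ((hq j).eventually_ne (hx j).symm).mono fun t ht => ht.symm
  rw [hrefl P Q hx]
  refine Tendsto.congr' (f₁ := fun t => expCoeff (p t) (fun j => -q t j) (-x)) ?_
    (tendsto_expCoeff (fun j => (hq j).neg) (fun z => ?_) fun j => neg_injective.ne (hx j))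
  · filter_upwards [hne] with t ht using (hrefl _ _ ht).symm
  · simpa only [neg_eq_iff_eq_neg, neg_neg] using hc (-z)

theorem tendsto_peakonDensity {p q : ℝ → Fin N → ℝ} {P Q : Fin N → ℝ} {l : Filter ℝ} {x : ℝ}
    (hA : Tendsto (fun t => expCoeff (p t) (q t) x) l (𝓝 (expCoeff P Q x)))
    (hB : Tendsto (fun t => expNegCoeff (p t) (q t) x) l (𝓝 (expNegCoeff P Q x))) :
    Tendsto (fun t => peakonDensity (p t) (q t) x) l (𝓝 (peakonDensity P Q x)) :=
  (((hA.pow 2).mul_const _).add ((hB.pow 2).mul_const _)).const_mul 2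

/-- Away from the clusters, the step functions are bounded by the total moments of the clusters. -/
theorem abs_sum_ite_le_sum_fiber (Q c : Fin N → ℝ) (s : Fin N → Prop) [DecidablePred s]
    (h : ∀ z ∈ Finset.univ.image Q, (∀ j, Q j = z → s j) ∨ ∀ j, Q j = z → ¬ s j) :
    |∑ j, if s j then c j else 0| ≤ ∑ z ∈ Finset.univ.image Q, |∑ j with Q j = z, c j| := by
  rw [sum_ite_eq_sum_fiber Q]
  refine (Finset.abs_sum_le_sum_abs _ _).trans (Finset.sum_le_sum fun z hz => ?_)
  rcases h z hz with h | h
  · rw [Finset.sum_congr rfl fun j hj => if_pos (h j (Finset.mem_filter.1 hj).2)]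
  · rw [Finset.sum_congr rfl fun j hj => if_neg (h j (Finset.mem_filter.1 hj).2)]
    simp

theorem abs_exp_mul_sub_le {β x z ℓ : ℝ} (hβ : |β| ≤ 1) (hx : |x - z| ≤ ℓ) (hℓ : ℓ ≤ 1) :
    |Real.exp (β * x) - Real.exp (β * z)| ≤ Real.exp (β * z) * (2 * ℓ) := by
  have h1 : |β * (x - z)| ≤ ℓ := by
    rw [abs_mul]
    calc _ ≤ 1 * |x - z| := mul_le_mul_of_nonneg_right hβ (abs_nonneg _)
      _ ≤ ℓ := by linarith
  have h2 := Real.abs_exp_sub_one_le (h1.trans hℓ)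
  have h3 : Real.exp (β * x) - Real.exp (β * z) =
      Real.exp (β * z) * (Real.exp (β * (x - z)) - 1) := by
    rw [mul_sub, ← Real.exp_add]; ring_nf
  rw [h3, abs_mul, abs_of_pos (Real.exp_pos _)]
  exact mul_le_mul_of_nonneg_left (by linarith) (Real.exp_pos _).le

theorem integrable_peakonDensity_zero (p q : Fin N → ℝ) : Integrable (peakonDensity p q) := by
  simpa using integrable_peakonDensity (β := 0) (by norm_num) p q

theorem expEnergy_zero (p q : Fin N → ℝ) : expEnergy 0 p q = ∫ x, peakonDensity p q x := by
  simp [expEnergy]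

/-- Two errors arise, relative to `e^{βz}`: freezing the weight costs at most `2ℓE`, and dropping
`u² ≤ E/2` on a length at most `2ℓ` costs at most `ℓE`. -/
theorem abs_cluster_energy_sub_le (p q : Fin N → ℝ) {β a b z ℓ : ℝ} (hβ : |β| ≤ 1) (hab : a ≤ b)
    (ha : |a - z| ≤ ℓ) (hb : |b - z| ≤ ℓ) (hℓ : ℓ ≤ 1) :
    |(∫ x in Set.Icc a b, peakonDensity p q x * Real.exp (β * x)) -
      Real.exp (β * z) * ∫ x in a..b, deriv (multipeakon p q) x ^ 2| ≤
      Real.exp (β * z) * (4 * ℓ * expEnergy 0 p q) := by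
  have hℓ0 : 0 ≤ ℓ := (abs_nonneg _).trans ha
  have hI := (integrable_peakonDensity (β := β) (by linarith) p q).integrableOn (s := Set.Icc a b)
  have hI0 := (integrable_peakonDensity_zero p q).integrableOn (s := Set.Icc a b)
  have hE : ∫ x in Set.Icc a b, peakonDensity p q x ≤ expEnergy 0 p q := by
    rw [expEnergy_zero]
    exact setIntegral_le_integral (integrable_peakonDensity_zero p q)
      (ae_of_all _ (peakonDensity_nonneg p q))
  have hu : ContinuousOn (fun x => multipeakon p q x ^ 2) (Set.Icc a b) := by
    unfold multipeakon; fun_prop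
  have hu2 := hu.integrableOn_Icc (μ := volume)
  have hdec : ∫ x in a..b, deriv (multipeakon p q) x ^ 2 =
      (∫ x in Set.Icc a b, peakonDensity p q x) - ∫ x in Set.Icc a b, multipeakon p q x ^ 2 := by
    rw [← integral_sub hI0 hu2, intervalIntegral.integral_of_le hab, ← integral_Icc_eq_integral_Ioc]
    refine integral_congr_ae (ae_restrict_of_ae ?_)
    filter_upwards [energyDensity_multipeakon_ae p q] with x hx
    rw [← hx, energyDensity]; ring
  have h1 : |∫ x in Set.Icc a b, peakonDensity p q x *
      (Real.exp (β * x) - Real.exp (β * z))| ≤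
      ∫ x in Set.Icc a b, peakonDensity p q x * (Real.exp (β * z) * (2 * ℓ)) := by
    rw [← Real.norm_eq_abs]
    refine norm_integral_le_of_norm_le (hI0.mul_const _) ?_
    filter_upwards [ae_restrict_mem measurableSet_Icc] with x hx
    rw [norm_mul, Real.norm_of_nonneg (peakonDensity_nonneg p q x)]
    refine mul_le_mul_of_nonneg_left (abs_exp_mul_sub_le hβ ?_ hℓ) (peakonDensity_nonneg p q x)
    rw [abs_le] at ha hb ⊢
    exact ⟨by linarith [hx.1], by linarith [hx.2]⟩
  rw [integral_mul_const] at h1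
  have h2 : 0 ≤ ∫ x in Set.Icc a b, multipeakon p q x ^ 2 := integral_nonneg fun x => sq_nonneg _
  have h3 : ∫ x in Set.Icc a b, multipeakon p q x ^ 2 ≤ ℓ * expEnergy 0 p q := by
    have : ∫ x in Set.Icc a b, multipeakon p q x ^ 2 ≤
        ∫ x in Set.Icc a b, expEnergy 0 p q / 2 :=
      setIntegral_mono hu2 (integrableOn_const (by simp)) fun x => by
        linarith [two_mul_multipeakon_sq_le p q x]
    refine this.trans ?_
    rw [setIntegral_const, Measure.real, Real.volume_Icc, ENNReal.toReal_ofReal (sub_nonneg.2 hab),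
      smul_eq_mul]
    have : b - a ≤ 2 * ℓ := by linarith [(abs_le.1 ha).1, (abs_le.1 hb).2]
    nlinarith [expEnergy_nonneg 0 p q]
  have h4 : (∫ x in Set.Icc a b, peakonDensity p q x * Real.exp (β * x)) -
      Real.exp (β * z) * ∫ x in a..b, deriv (multipeakon p q) x ^ 2 =
      (∫ x in Set.Icc a b, peakonDensity p q x * (Real.exp (β * x) - Real.exp (β * z))) +
        Real.exp (β * z) * ∫ x in Set.Icc a b, multipeakon p q x ^ 2 := by
    simp only [mul_sub]
    rw [integral_sub hI (hI0.mul_const _), integral_mul_const, hdec]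
    ring
  have hw := Real.exp_pos (β * z)
  rw [h4]
  refine (abs_add_le _ _).trans ?_
  rw [abs_of_nonneg (mul_nonneg hw.le h2)]
  have h5 := mul_le_mul_of_nonneg_left h3 hw.le
  have h6 := mul_le_mul_of_nonneg_right hE (mul_nonneg hw.le (mul_nonneg zero_le_two hℓ0))
  have h7 : 0 ≤ Real.exp (β * z) * (ℓ * expEnergy 0 p q) :=
    mul_nonneg hw.le (mul_nonneg hℓ0 (expEnergy_nonneg 0 p q))
  linarith

theorem tendsto_cluster_energy {p q : ℝ → Fin N → ℝ} {τ M β z e : ℝ} (hβ : |β| ≤ 1) {a b : Fin N}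
    (ha : Tendsto (fun t => q t a) (𝓝[≠] τ) (𝓝 z))
    (hb : Tendsto (fun t => q t b) (𝓝[≠] τ) (𝓝 z))
    (hab : ∀ᶠ t in 𝓝[≠] τ, q t a ≤ q t b)
    (hM : ∀ᶠ t in 𝓝[≠] τ, expEnergy 0 (p t) (q t) ≤ M)
    (he : Tendsto (fun t => ∫ x in (q t a)..(q t b), deriv (multipeakon (p t) (q t)) x ^ 2)
      (𝓝[≠] τ) (𝓝 e)) :
    Tendsto (fun t => ∫ x in Set.Icc (q t a) (q t b),
      peakonDensity (p t) (q t) x * Real.exp (β * x)) (𝓝[≠] τ) (𝓝 (Real.exp (β * z) * e)) := by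
  have hℓ : Tendsto (fun t => |q t a - z| + |q t b - z|) (𝓝[≠] τ) (𝓝 0) := by
    simpa using ((ha.sub_const z).abs).add ((hb.sub_const z).abs)
  have hlim : Tendsto (fun t => Real.exp (β * z) * (4 * (|q t a - z| + |q t b - z|) * M))
      (𝓝[≠] τ) (𝓝 0) := by
    simpa using ((hℓ.const_mul 4).mul_const M).const_mul (Real.exp (β * z))
  have h0 : Tendsto (fun t => (∫ x in Set.Icc (q t a) (q t b),
      peakonDensity (p t) (q t) x * Real.exp (β * x)) - Real.exp (β * z) *
      ∫ x in (q t a)..(q t b), deriv (multipeakon (p t) (q t)) x ^ 2) (𝓝[≠] τ) (𝓝 0) := by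
    refine squeeze_zero_norm' ?_ hlim
    filter_upwards [hab, hM, hℓ.eventually_le_const one_pos] with t h1 h2 h3
    refine (abs_cluster_energy_sub_le (p t) (q t) hβ h1
      (le_add_of_nonneg_right (abs_nonneg _)) (le_add_of_nonneg_left (abs_nonneg _)) h3).trans ?_
    gcongr
  simpa using h0.add (he.const_mul (Real.exp (β * z)))

/-! ### Continuity of the weighted energy through an interaction -/

namespace IsConservativeMultipeakonFlow

variable {p q : ℝ → Fin N → ℝ} {S : Set ℝ}

theorem eventually_notMem (hf : IsConservativeMultipeakonFlow p q S) (τ : ℝ) :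
    ∀ᶠ t in 𝓝[≠] τ, t ∉ S := by
  have hfin : ((S ∩ Set.Icc (τ - 1) (τ + 1)) \ {τ}).Finite := (hf.locallyFinite _ _).sdiff
  have h1 : ((S ∩ Set.Icc (τ - 1) (τ + 1)) \ {τ})ᶜ ∈ 𝓝 τ :=
    hfin.isClosed.isOpen_compl.mem_nhds (by simp)
  have h2 : Set.Icc (τ - 1) (τ + 1) ∈ 𝓝 τ := Icc_mem_nhds (by linarith) (by linarith)
  filter_upwards [nhdsWithin_le_nhds h1, nhdsWithin_le_nhds h2, self_mem_nhdsWithin] with t a b c hS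
  exact a ⟨⟨hS, b⟩, c⟩

theorem countable (hf : IsConservativeMultipeakonFlow p q S) : S.Countable := by
  have : S = ⋃ n : ℕ, S ∩ Set.Icc (-n : ℝ) n := by
    rw [← Set.inter_iUnion, Set.left_eq_inter]
    intro x _
    obtain ⟨n, hn⟩ := exists_nat_ge |x|
    exact Set.mem_iUnion.2 ⟨n, abs_le.1 hn⟩
  rw [this]
  exact Set.countable_iUnion fun n => (hf.locallyFinite _ _).countable

theorem tendsto_q (hf : IsConservativeMultipeakonFlow p q S) (τ : ℝ) (i : Fin N) :
    Tendsto (fun t => q t i) (𝓝[≠] τ) (𝓝 (q τ i)) :=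
  ((hf.continuous_q i).tendsto τ).mono_left nhdsWithin_le_nhds

theorem monotone (hf : IsConservativeMultipeakonFlow p q S) (τ : ℝ) : Monotone (q τ) :=
  fun i j hij => le_of_tendsto_of_tendsto (hf.tendsto_q τ i) (hf.tendsto_q τ j)
    ((hf.eventually_notMem τ).mono fun t ht => (hf.strictMono t ht).monotone hij)

theorem hasDerivAt_expEnergy (hf : IsConservativeMultipeakonFlow p q S) {β : ℝ} (hβ : |β| < 2)
    {t : ℝ} (ht : t ∉ S) :
    HasDerivAt (fun s => expEnergy β (p s) (q s)) (2 * β * ∫ x, multipeakon (p t) (q t) x *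
      energySource (p t) (q t) x * Real.exp (β * x)) t :=
  _root_.hasDerivAt_expEnergy hβ (hf.strictMono t ht).injective (hf.deriv_q t ht) (hf.deriv_p t ht)

theorem expEnergy_zero_eq (hf : IsConservativeMultipeakonFlow p q S) {s : Set ℝ} (hs : IsOpen s)
    (hs' : IsPreconnected s) (hsS : ∀ t ∈ s, t ∉ S) {t₁ t₂ : ℝ} (h₁ : t₁ ∈ s) (h₂ : t₂ ∈ s) :
    expEnergy 0 (p t₁) (q t₁) = expEnergy 0 (p t₂) (q t₂) := by
  have hd : ∀ t ∈ s, HasDerivAt (fun s => expEnergy 0 (p s) (q s)) 0 t := fun t ht => by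
    simpa using hf.hasDerivAt_expEnergy (β := 0) (by norm_num) (hsS t ht)
  exact hs.is_const_of_deriv_eq_zero hs' (f := fun s => expEnergy 0 (p s) (q s))
    (fun t ht => (hd t ht).differentiableAt.differentiableWithinAt)
    (fun t ht => (hd t ht).deriv) h₁ h₂

/-- The energy is constant on a punctured neighbourhood's two halves separately. This bound does not
presuppose that the two constants agree, which keeps the passage through `τ` from being circular. -/
theorem exists_expEnergy_zero_le (hf : IsConservativeMultipeakonFlow p q S) (τ : ℝ) :
    ∃ M, ∀ᶠ t in 𝓝[≠] τ, expEnergy 0 (p t) (q t) ≤ M := by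
  obtain ⟨δ, hδ, h⟩ := Metric.eventually_nhds_iff.1
    (eventually_nhdsWithin_iff.1 (hf.eventually_notMem τ))
  have hl : ∀ t ∈ Set.Ioo (τ - δ) τ, t ∉ S := fun t ht =>
    h (by rw [Real.dist_eq, abs_lt]; constructor <;> linarith [ht.1, ht.2]) ht.2.ne
  have hr : ∀ t ∈ Set.Ioo τ (τ + δ), t ∉ S := fun t ht =>
    h (by rw [Real.dist_eq, abs_lt]; constructor <;> linarith [ht.1, ht.2]) ht.1.ne'
  refine ⟨max (expEnergy 0 (p (τ - δ / 2)) (q (τ - δ / 2)))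
    (expEnergy 0 (p (τ + δ / 2)) (q (τ + δ / 2))), ?_⟩
  have hn : Set.Ioo (τ - δ) (τ + δ) ∈ 𝓝 τ := Ioo_mem_nhds (by linarith) (by linarith)
  filter_upwards [nhdsWithin_le_nhds hn, self_mem_nhdsWithin] with t ht hne
  rcases lt_or_gt_of_ne (show t ≠ τ from hne) with h' | h'
  · refine le_trans (le_of_eq ?_) (le_max_left _ _)
    exact hf.expEnergy_zero_eq isOpen_Ioo isPreconnected_Ioo hl ⟨ht.1, h'⟩
      ⟨by linarith, by linarith⟩
  · refine le_trans (le_of_eq ?_) (le_max_right _ _)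
    exact hf.expEnergy_zero_eq isOpen_Ioo isPreconnected_Ioo hr ⟨h', ht.2⟩
      ⟨by linarith, by linarith⟩

theorem exists_cluster (hf : IsConservativeMultipeakonFlow p q S) {τ z : ℝ}
    (hz : z ∈ Finset.univ.image (q τ)) :
    ∃ a b, q τ a = z ∧ q τ b = z ∧ ∀ i, q τ i = z ↔ a ≤ i ∧ i ≤ b := by
  obtain ⟨i₀, -, hi₀⟩ := Finset.mem_image.1 hz
  have hne : (Finset.univ.filter fun i => q τ i = z).Nonempty := ⟨i₀, by simpa using hi₀⟩
  have ha := (Finset.mem_filter.1 (Finset.min'_mem _ hne)).2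
  have hb := (Finset.mem_filter.1 (Finset.max'_mem _ hne)).2
  refine ⟨_, _, ha, hb, fun i => ⟨fun hi => ?_, fun hi => ?_⟩⟩
  · have hi' : i ∈ Finset.univ.filter fun i => q τ i = z := by simpa using hi
    exact ⟨Finset.min'_le _ _ hi', Finset.le_max' _ _ hi'⟩
  · exact le_antisymm ((hf.monotone τ hi.2).trans hb.le) (ha.ge.trans (hf.monotone τ hi.1))

theorem tendsto_sum_fiber (hf : IsConservativeMultipeakonFlow p q S) {τ : ℝ} (hτ : τ ∈ S) (z : ℝ) :
    Tendsto (fun t => ∑ j with q τ j = z, p t j) (𝓝[≠] τ) (𝓝 (∑ j with q τ j = z, p τ j)) := by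
  by_cases hz : z ∈ Finset.univ.image (q τ)
  · obtain ⟨a, b, ha, -, hab⟩ := hf.exists_cluster hz
    have hIcc : Finset.univ.filter (fun j => q τ j = z) = Finset.Icc a b := by
      ext j; simp [hab]
    rw [hIcc]
    exact hf.strength τ hτ a b fun i => ha ▸ hab i
  · have hempty : Finset.univ.filter (fun j => q τ j = z) = ∅ := by
      refine Finset.filter_eq_empty_iff.2 fun j _ hj => hz ?_
      exact Finset.mem_image.2 ⟨j, Finset.mem_univ j, hj⟩
    simp [hempty]

end IsConservativeMultipeakonFlow

/-- The region which is not covered by the intervals spanned by finitely many clusters. -/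
def clusterGap {N : ℕ} (Z : Finset ℝ) (a b : ℝ → Fin N) (q : Fin N → ℝ) : Set ℝ :=
  (⋃ z ∈ Z, Set.Icc (q (a z)) (q (b z)))ᶜ

theorem measurableSet_clusterGap (Z : Finset ℝ) (a b : ℝ → Fin N) (q : Fin N → ℝ) :
    MeasurableSet (clusterGap Z a b q) :=
  (Finset.measurableSet_biUnion _ fun _ _ => measurableSet_Icc).compl

/-- In the gap no cluster straddles `x`, so both coefficients are bounded by cluster moments.
Moreover `A` vanishes for `x ≥ R` and `B` for `x < -R`, which makes the majorant integrable when
`|β| < 2`. -/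
theorem peakonDensity_mul_exp_le_of_mem_clusterGap {p q Q : Fin N → ℝ} {a b : ℝ → Fin N}
    (hab : ∀ z ∈ Finset.univ.image Q, ∀ j, Q j = z → a z ≤ j ∧ j ≤ b z) (hq : Monotone q)
    {β C R x : ℝ} (hR : ∀ j, |q j| < R)
    (hA : ∑ z ∈ Finset.univ.image Q, |∑ j with Q j = z, p j * Real.exp (-q j)| ≤ C)
    (hB : ∑ z ∈ Finset.univ.image Q, |∑ j with Q j = z, p j * Real.exp (q j)| ≤ C)
    (hx : x ∈ clusterGap (Finset.univ.image Q) a b q) :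
    peakonDensity p q x * Real.exp (β * x) ≤
      2 * C ^ 2 * ((if x < R then Real.exp ((2 + β) * x) else 0) +
        if -R ≤ x then Real.exp ((β - 2) * x) else 0) := by
  have hside : ∀ z ∈ Finset.univ.image Q, x < q (a z) ∨ q (b z) < x := by
    intro z hz
    by_contra! hcon
    exact hx (Set.mem_biUnion hz ⟨hcon.1, hcon.2⟩)
  have hA' : |expCoeff p q x| ≤ if x < R then C else 0 := by
    split_ifs with h
    · refine (abs_sum_ite_le_sum_fiber Q _ _ fun z hz => ?_).trans hA
      rcases hside z hz with h' | h'
      · exact Or.inl fun j hj => h'.trans_le (hq (hab z hz j hj).1)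
      · exact Or.inr fun j hj => ((hq (hab z hz j hj).2).trans h'.le).not_gt
    · have : expCoeff p q x = 0 := Finset.sum_eq_zero fun j _ =>
        if_neg ((abs_lt.1 (hR j)).2.le.trans (not_lt.1 h)).not_gt
      rw [this, abs_zero]
  have hB' : |expNegCoeff p q x| ≤ if -R ≤ x then C else 0 := by
    split_ifs with h
    · refine (abs_sum_ite_le_sum_fiber Q _ _ fun z hz => ?_).trans hB
      rcases hside z hz with h' | h'
      · exact Or.inr fun j hj => (h'.trans_le (hq (hab z hz j hj).1)).not_ge
      · exact Or.inl fun j hj => (hq (hab z hz j hj).2).trans h'.le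
    · have : expNegCoeff p q x = 0 := Finset.sum_eq_zero fun j _ =>
        if_neg ((not_le.1 h).trans (abs_lt.1 (hR j)).1).not_ge
      rw [this, abs_zero]
  have hA2 := pow_le_pow_left₀ (abs_nonneg _) hA' 2
  have hB2 := pow_le_pow_left₀ (abs_nonneg _) hB' 2
  rw [sq_abs] at hA2 hB2
  have e1 : Real.exp (2 * x) * Real.exp (β * x) = Real.exp ((2 + β) * x) := by
    rw [← Real.exp_add]; ring_nf
  have e2 : Real.exp (-(2 * x)) * Real.exp (β * x) = Real.exp ((β - 2) * x) := by
    rw [← Real.exp_add]; ring_nf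
  rw [peakonDensity_mul_exp, mul_assoc (_ ^ 2), mul_assoc (_ ^ 2), e1, e2]
  calc _ ≤ 2 * ((if x < R then C else 0) ^ 2 * Real.exp ((2 + β) * x)) +
        2 * ((if -R ≤ x then C else 0) ^ 2 * Real.exp ((β - 2) * x)) := by gcongr
    _ = _ := by split_ifs <;> ring

theorem tendsto_integral_clusterGap {p q : ℝ → Fin N → ℝ} {P Q : Fin N → ℝ} {l : Filter ℝ}
    [l.IsCountablyGenerated] {β : ℝ} (hβ : |β| < 2)
    (hq : ∀ j, Tendsto (fun t => q t j) l (𝓝 (Q j)))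
    (hmono : ∀ᶠ t in l, Monotone (q t))
    (hA : ∀ z, Tendsto (fun t => ∑ j with Q j = z, p t j * Real.exp (-q t j)) l
      (𝓝 (∑ j with Q j = z, P j * Real.exp (-Q j))))
    (hB : ∀ z, Tendsto (fun t => ∑ j with Q j = z, p t j * Real.exp (q t j)) l
      (𝓝 (∑ j with Q j = z, P j * Real.exp (Q j))))
    {a b : ℝ → Fin N}
    (ha : ∀ z ∈ Finset.univ.image Q, Q (a z) = z) (hb : ∀ z ∈ Finset.univ.image Q, Q (b z) = z)
    (hab : ∀ z ∈ Finset.univ.image Q, ∀ j, Q j = z → a z ≤ j ∧ j ≤ b z) :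
    Tendsto (fun t => ∫ x in clusterGap (Finset.univ.image Q) a b (q t),
      peakonDensity (p t) (q t) x * Real.exp (β * x)) l (𝓝 (expEnergy β P Q)) := by
  -- The added `1`, here and in `R`, leaves room for bounds on the limits to hold eventually along
  -- the filter.
  set C : ℝ := (∑ z ∈ Finset.univ.image Q, |∑ j with Q j = z, P j * Real.exp (-Q j)|) +
    (∑ z ∈ Finset.univ.image Q, |∑ j with Q j = z, P j * Real.exp (Q j)|) + 1 with hC
  set R : ℝ := (∑ j, |Q j|) + 1 with hR
  have hAC : ∀ᶠ t in l, ∑ z ∈ Finset.univ.image Q, |∑ j with Q j = z, p t j * Real.exp (-q t j)|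
      ≤ C := by
    refine (tendsto_finsetSum _ fun z _ => (hA z).abs).eventually_le_const ?_
    have : 0 ≤ ∑ z ∈ Finset.univ.image Q, |∑ j with Q j = z, P j * Real.exp (Q j)| :=
      Finset.sum_nonneg fun _ _ => abs_nonneg _
    linarith
  have hBC : ∀ᶠ t in l, ∑ z ∈ Finset.univ.image Q, |∑ j with Q j = z, p t j * Real.exp (q t j)|
      ≤ C := by
    refine (tendsto_finsetSum _ fun z _ => (hB z).abs).eventually_le_const ?_
    have : 0 ≤ ∑ z ∈ Finset.univ.image Q, |∑ j with Q j = z, P j * Real.exp (-Q j)| :=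
      Finset.sum_nonneg fun _ _ => abs_nonneg _
    linarith
  have hqR : ∀ᶠ t in l, ∀ j, |q t j| < R := by
    rw [eventually_all]
    intro j
    refine (hq j).abs.eventually_lt_const ?_
    have := Finset.single_le_sum (f := fun j => |Q j|) (fun j _ => abs_nonneg _)
      (Finset.mem_univ j)
    simp only [hR]
    linarith
  simp only [← integral_indicator (measurableSet_clusterGap _ _ _ _)]
  refine tendsto_integral_filter_of_dominated_convergence (fun x => 2 * C ^ 2 *
    ((if x < R then Real.exp ((2 + β) * x) else 0) +
      if -R ≤ x then Real.exp ((β - 2) * x) else 0)) ?_ ?_ ?_ ?_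
  · refine Eventually.of_forall fun t => ?_
    exact ((integrable_peakonDensity hβ (p t) (q t)).indicator
      (measurableSet_clusterGap _ _ _ _)).aestronglyMeasurable
  · filter_upwards [hmono, hAC, hBC, hqR] with t h1 h2 h3 h4
    refine ae_of_all _ fun x => ?_
    by_cases hx : x ∈ clusterGap (Finset.univ.image Q) a b (q t)
    · rw [Set.indicator_of_mem hx, Real.norm_of_nonneg
        (mul_nonneg (peakonDensity_nonneg _ _ x) (Real.exp_pos _).le)]
      exact peakonDensity_mul_exp_le_of_mem_clusterGap hab h1 h4 h2 h3 hx
    · rw [Set.indicator_of_notMem hx, norm_zero]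
      positivity
  · obtain ⟨h1, h2⟩ := abs_lt.1 hβ
    exact ((integrable_ite_lt_exp (by linarith) _).add
      (integrable_ite_le_exp (by linarith) _)).const_mul _
  · filter_upwards [ae_forall_ne Q] with x hx
    have hgap : ∀ᶠ t in l, x ∈ clusterGap (Finset.univ.image Q) a b (q t) := by
      have : ∀ᶠ t in l, ∀ z ∈ Finset.univ.image Q, x ∉ Set.Icc (q t (a z)) (q t (b z)) := by
        rw [eventually_all_finset]
        intro z hz
        rcases lt_or_gt_of_ne (hx (a z)) with h | h
        · filter_upwards [(hq (a z)).eventually_const_lt h] with t ht hcon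
          exact ht.not_ge hcon.1
        · have h' : Q (b z) < x := by rwa [hb z hz, ← ha z hz]
          filter_upwards [(hq (b z)).eventually_lt_const h'] with t ht hcon
          exact ht.not_ge hcon.2
      filter_upwards [this] with t ht
      simpa [clusterGap] using ht
    have hlim := (tendsto_peakonDensity (tendsto_expCoeff hq hA hx)
      (tendsto_expNegCoeff hq hB hx)).mul_const (Real.exp (β * x))
    refine hlim.congr' ?_
    filter_upwards [hgap] with t ht
    rw [Set.indicator_of_mem ht]

namespace IsConservativeMultipeakonFlow

variable {p q : ℝ → Fin N → ℝ} {S : Set ℝ}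

/-- The weighted energy has a limit at an interaction time; a part of it may concentrate. -/
theorem exists_tendsto_expEnergy (hf : IsConservativeMultipeakonFlow p q S) {τ : ℝ} (hτ : τ ∈ S)
    {β : ℝ} (hβ : |β| ≤ 1) :
    ∃ L, Tendsto (fun t => expEnergy β (p t) (q t)) (𝓝[≠] τ) (𝓝 L) ∧
      expEnergy β (p τ) (q τ) ≤ L := by
  rcases isEmpty_or_nonempty (Fin N) with hN | hN
  · refine ⟨0, ?_, ?_⟩ <;> simp [expEnergy_eq_sum (show |β| < 2 by linarith)]
  have hβ2 : |β| < 2 := by linarith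
  obtain ⟨M, hM⟩ := hf.exists_expEnergy_zero_le τ
  have hcl : ∀ z, ∃ a b, z ∈ Finset.univ.image (q τ) →
      q τ a = z ∧ q τ b = z ∧ ∀ i, q τ i = z ↔ a ≤ i ∧ i ≤ b := by
    intro z
    by_cases hz : z ∈ Finset.univ.image (q τ)
    · obtain ⟨a, b, h⟩ := hf.exists_cluster hz
      exact ⟨a, b, fun _ => h⟩
    · exact ⟨Classical.arbitrary _, Classical.arbitrary _, fun h => absurd h hz⟩
  choose a b hab using hcl
  have ha := fun z hz => (hab z hz).1
  have hb := fun z hz => (hab z hz).2.1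
  have hi := fun z hz => (hab z hz).2.2
  have hable : ∀ z ∈ Finset.univ.image (q τ), a z ≤ b z := fun z hz =>
    ((hi z hz (b z)).1 (hb z hz)).1
  have hmono : ∀ᶠ t in 𝓝[≠] τ, StrictMono (q t) := (hf.eventually_notMem τ).mono hf.strictMono
  have hen : ∀ z, ∃ e, z ∈ Finset.univ.image (q τ) → 0 ≤ e ∧
      Tendsto (fun t => ∫ x in (q t (a z))..(q t (b z)), deriv (multipeakon (p t) (q t)) x ^ 2)
        (𝓝[≠] τ) (𝓝 e) := by
    intro z
    by_cases hz : z ∈ Finset.univ.image (q τ)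
    · obtain ⟨e, he⟩ := hf.energy τ hτ (a z) (b z) fun i => by rw [ha z hz]; exact hi z hz i
      refine ⟨e, fun _ => ⟨ge_of_tendsto he ?_, he⟩⟩
      filter_upwards [hmono] with t ht
      exact intervalIntegral.integral_nonneg (ht.monotone (hable z hz)) fun x _ => sq_nonneg _
    · exact ⟨0, fun h => absurd h hz⟩
  choose e he using hen
  have hgap := tendsto_integral_clusterGap (P := p τ) (a := a) (b := b) hβ2 (hf.tendsto_q τ)
    (hmono.mono fun t ht => ht.monotone)
    (fun z => tendsto_sum_cluster_exp (hf.tendsto_q τ) hM (hf.tendsto_sum_fiber hτ z))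
    (fun z => tendsto_sum_cluster_exp_neg (hf.tendsto_q τ) hM (hf.tendsto_sum_fiber hτ z))
    ha hb fun z hz j hj => (hi z hz j).1 hj
  have hclus := tendsto_finsetSum (Finset.univ.image (q τ)) fun z hz =>
    tendsto_cluster_energy (p := p) (z := z) hβ
      (by simpa only [ha z hz] using hf.tendsto_q τ (a z))
      (by simpa only [hb z hz] using hf.tendsto_q τ (b z))
      (hmono.mono fun t ht => ht.monotone (hable z hz)) hM (he z hz).2
  -- The limit is the concentrated energy `∑ e^{βz} e_z` plus the weighted energy of the profile at
  -- `τ`; the first part is nonnegative.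
  refine ⟨_, (hclus.add hgap).congr' ?_, le_add_of_nonneg_left
    (Finset.sum_nonneg fun z hz => mul_nonneg (Real.exp_pos _).le (he z hz).1)⟩
  filter_upwards [hmono] with t ht
  have hint := integrable_peakonDensity hβ2 (p t) (q t)
  have hdisj : Set.Pairwise (↑(Finset.univ.image (q τ)))
      (Function.onFun Disjoint fun z => Set.Icc (q t (a z)) (q t (b z))) := by
    have key : ∀ z ∈ Finset.univ.image (q τ), ∀ z' ∈ Finset.univ.image (q τ), z < z' →
        Disjoint (Set.Icc (q t (a z)) (q t (b z))) (Set.Icc (q t (a z')) (q t (b z'))) := by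
      intro z hz z' hz' hlt
      have hlt' : b z < a z' := by
        by_contra! hcon
        have := hf.monotone τ hcon
        rw [ha z' hz', hb z hz] at this
        linarith
      exact Set.disjoint_left.2 fun x hx hx' => ((ht hlt').trans_le hx'.1).not_ge hx.2
    intro z hz z' hz' hne
    rcases lt_or_gt_of_ne hne with h | h
    · exact key z hz z' hz' h
    · exact (key z' hz' z hz h).symm
  rw [← integral_biUnion_finset _ (fun _ _ => measurableSet_Icc) hdisj
    (fun _ _ => hint.integrableOn), clusterGap,
    integral_add_compl (Finset.measurableSet_biUnion _ fun _ _ => measurableSet_Icc) hint,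
    expEnergy]

end IsConservativeMultipeakonFlow

/-! ### A Gronwall estimate with exceptional points -/

theorem le_mul_exp_of_abs_deriv_le_of_nonneg {f f' : ℝ → ℝ} {S : Set ℝ} {c : ℝ}
    (hf : Continuous f) (hS : S.Countable) (hd : ∀ t ∉ S, HasDerivAt f (f' t) t)
    (hb : ∀ t ∉ S, |f' t| ≤ c * f t) {t : ℝ} (ht : 0 ≤ t) :
    f t ≤ f 0 * Real.exp (c * t) := by
  set G : ℝ → ℝ := fun s => f s * Real.exp (-(c * s)) with hG
  have hGc : Continuous G := by fun_prop
  have hGd : ∀ s ∉ S, HasDerivAt G ((f' s - c * f s) * Real.exp (-(c * s))) s := fun s hs => by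
    refine ((hd s hs).mul (((hasDerivAt_id s).const_mul c).neg.exp)).congr_deriv ?_
    simp only [id, Pi.neg_apply]
    ring_nf
  have hae : ∀ᵐ s : ℝ, s ∉ S := by
    rw [ae_iff]
    simpa using hS.measure_zero volume
  -- Off `S` one has `|f' - c f| ≤ 2 c f`, so a continuous function dominates `G'` almost
  -- everywhere; this justifies the fundamental theorem off a countable set.
  have hint : IntervalIntegrable (deriv G) volume 0 t := by
    refine ((show Continuous fun s => 2 * (c * f s) * Real.exp (-(c * s)) by
      fun_prop).intervalIntegrable 0 t).mono_fun (measurable_deriv G).aestronglyMeasurable ?_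
    filter_upwards [ae_restrict_of_ae hae] with s hs
    have h1 := abs_le.1 (hb s hs)
    have h2 := (abs_nonneg _).trans (hb s hs)
    rw [(hGd s hs).deriv, norm_mul, norm_mul _ (Real.exp _)]
    refine mul_le_mul_of_nonneg_right ?_ (norm_nonneg _)
    rw [Real.norm_eq_abs, Real.norm_eq_abs, abs_of_nonneg (a := 2 * (c * f s)) (by linarith),
      abs_le]
    exact ⟨by linarith, by linarith⟩
  have hFTC := integral_eq_of_hasDerivAt_off_countable_of_le G (deriv G) ht hS hGc.continuousOn
    (fun s hs => (hGd s hs.2).differentiableAt.hasDerivAt) hint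
  have hle : ∫ s in (0 : ℝ)..t, deriv G s ≤ 0 := by
    rw [intervalIntegral.integral_of_le ht]
    refine integral_nonpos_of_ae ?_
    filter_upwards [ae_restrict_of_ae hae] with s hs
    rw [(hGd s hs).deriv]
    exact mul_nonpos_of_nonpos_of_nonneg (by linarith [(abs_le.1 (hb s hs)).2]) (Real.exp_pos _).le
  have h0 : G t ≤ f 0 := by
    have : G 0 = f 0 := by simp [hG]
    linarith
  have h1 := mul_le_mul_of_nonneg_right h0 (Real.exp_pos (c * t)).le
  rwa [hG, mul_assoc, ← Real.exp_add, neg_add_cancel, Real.exp_zero, mul_one] at h1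

/-- The two-sided bound on the derivative is invariant under time reversal, which gives negative
times. -/
theorem le_mul_exp_of_abs_deriv_le {f f' : ℝ → ℝ} {S : Set ℝ} {c : ℝ}
    (hf : Continuous f) (hS : S.Countable) (hd : ∀ t ∉ S, HasDerivAt f (f' t) t)
    (hb : ∀ t ∉ S, |f' t| ≤ c * f t) (t : ℝ) :
    f t ≤ f 0 * Real.exp (c * |t|) := by
  rcases le_total 0 t with ht | ht
  · rw [abs_of_nonneg ht]
    exact le_mul_exp_of_abs_deriv_le_of_nonneg hf hS hd hb ht
  · rw [abs_of_nonpos ht]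
    have h := le_mul_exp_of_abs_deriv_le_of_nonneg (f := fun s => f (-s)) (f' := fun s => -f' (-s))
      (S := Neg.neg ⁻¹' S) (c := c) (by fun_prop) (hS.preimage neg_injective)
      (fun s hs => ((hd (-s) hs).comp s (hasDerivAt_neg s)).congr_deriv (by ring))
      (fun s hs => by simpa only [abs_neg] using hb (-s) hs) (neg_nonneg.2 ht)
    simpa using h

/-! ### Propagation of the weighted energy along the flow -/

namespace IsConservativeMultipeakonFlow

variable {p q : ℝ → Fin N → ℝ} {S : Set ℝ}

theorem expEnergy_le_of_rate (hf : IsConservativeMultipeakonFlow p q S) {β c : ℝ} (hβ : |β| ≤ 1)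
    (hc : ∀ t ∉ S, |2 * β * ∫ x, multipeakon (p t) (q t) x * energySource (p t) (q t) x *
      Real.exp (β * x)| ≤ c * expEnergy β (p t) (q t)) (t : ℝ) :
    expEnergy β (p t) (q t) ≤ expEnergy β (p 0) (q 0) * Real.exp (c * |t|) := by
  classical
  have hL : ∀ τ, ∃ L, τ ∈ S → Tendsto (fun t => expEnergy β (p t) (q t)) (𝓝[≠] τ) (𝓝 L) ∧
      expEnergy β (p τ) (q τ) ≤ L := by
    intro τ
    by_cases hτ : τ ∈ S
    · obtain ⟨L, h⟩ := hf.exists_tendsto_expEnergy hτ hβ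
      exact ⟨L, fun _ => h⟩
    · exact ⟨0, fun h => absurd h hτ⟩
  choose L hL using hL
  -- The weighted energy itself may drop at an interaction time; inserting its limit there restores
  -- continuity and only increases the function.
  set F : ℝ → ℝ := fun t => if t ∈ S then L t else expEnergy β (p t) (q t) with hF
  have hev : ∀ τ, F =ᶠ[𝓝[≠] τ] fun t => expEnergy β (p t) (q t) := fun τ =>
    (hf.eventually_notMem τ).mono fun t ht => if_neg ht
  have hev' : ∀ τ ∉ S, F =ᶠ[𝓝 τ] fun t => expEnergy β (p t) (q t) := by
    intro τ hτ
    filter_upwards [eventually_nhdsWithin_iff.1 (hev τ)] with t ht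
    by_cases h : t = τ
    · rw [h]; exact if_neg hτ
    · exact ht h
  have hd : ∀ τ ∉ S, HasDerivAt F _ τ := fun τ hτ =>
    (hf.hasDerivAt_expEnergy (β := β) (by linarith) hτ).congr_of_eventuallyEq (hev' τ hτ)
  have hcont : Continuous F := by
    rw [continuous_iff_continuousAt]
    intro τ
    by_cases hτ : τ ∈ S
    · rw [continuousAt_iff_punctured_nhds]
      have : F τ = L τ := if_pos hτ
      rw [this]
      exact (hL τ hτ).1.congr' (hev τ).symm
    · exact (hd τ hτ).continuousAt
  have hG := le_mul_exp_of_abs_deriv_le (c := c) hcont hf.countable hd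
    (fun τ hτ => by simpa only [hF, if_neg hτ] using hc τ hτ) t
  have h0 : F 0 = expEnergy β (p 0) (q 0) := if_neg hf.zero_notMem
  rw [h0] at hG
  refine le_trans ?_ hG
  by_cases ht : t ∈ S
  · simpa only [hF, if_pos ht] using (hL t ht).2
  · simp only [hF, if_neg ht, le_refl]

theorem expEnergy_zero_le (hf : IsConservativeMultipeakonFlow p q S) (t : ℝ) :
    expEnergy 0 (p t) (q t) ≤ expEnergy 0 (p 0) (q 0) := by
  simpa using hf.expEnergy_le_of_rate (β := 0) (c := 0) (by simp) (by simp) t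

/-- The rate constant involves the current energy, which the case `β = 0` bounds by the initial one;
this makes the Gronwall constant independent of time. -/
theorem expEnergy_le (hf : IsConservativeMultipeakonFlow p q S) {β : ℝ} (hβ : |β| < 1) (t : ℝ) :
    expEnergy β (p t) (q t) ≤ expEnergy β (p 0) (q 0) *
      Real.exp (2 * √(expEnergy 0 (p 0) (q 0)) * (3 / (2 * (1 - |β|))) * |t|) := by
  refine hf.expEnergy_le_of_rate hβ.le (fun s _ => ?_) t
  refine (abs_integral_multipeakon_mul_energySource_le hβ _ _).trans ?_
  have h1 := Real.sqrt_le_sqrt (hf.expEnergy_zero_le s)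
  have h2 : 0 ≤ 3 / (2 * (1 - |β|)) := div_nonneg (by norm_num) (by linarith)
  have h3 := expEnergy_nonneg β (p s) (q s)
  gcongr

end IsConservativeMultipeakonFlow

/-! ### The weighted energy and the nonlocal term -/

theorem exp_mul_abs_le (α x : ℝ) :
    Real.exp (α * |x|) ≤ Real.exp (α * x) + Real.exp (-α * x) := by
  rcases abs_choice x with h | h <;> rw [h]
  · linarith [Real.exp_pos (-α * x)]
  · rw [mul_neg, ← neg_mul]
    linarith [Real.exp_pos (α * x)]

theorem energyDensity_nonneg (f : ℝ → ℝ) (x : ℝ) : 0 ≤ energyDensity f x := by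
  unfold energyDensity; positivity

theorem weightedEnergy_nonneg (α : ℝ) (f : ℝ → ℝ) : 0 ≤ weightedEnergy α f :=
  integral_nonneg fun x => mul_nonneg (energyDensity_nonneg f x) (Real.exp_pos _).le

theorem hasFiniteWeightedEnergy_multipeakon {α : ℝ} (hα : |α| < 2) (p q : Fin N → ℝ) :
    HasFiniteWeightedEnergy α (multipeakon p q) ∧
      weightedEnergy α (multipeakon p q) ≤ expEnergy α p q + expEnergy (-α) p q := by
  have hI1 := integrable_peakonDensity hα p q
  have hI2 := integrable_peakonDensity (β := -α) (by rwa [abs_neg]) p q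
  have hae : (fun x => energyDensity (multipeakon p q) x * Real.exp (α * |x|)) =ᵐ[volume]
      fun x => peakonDensity p q x * Real.exp (α * |x|) :=
    (energyDensity_multipeakon_ae p q).mul (EventuallyEq.refl _ _)
  have hle : ∀ x, peakonDensity p q x * Real.exp (α * |x|) ≤
      peakonDensity p q x * Real.exp (α * x) + peakonDensity p q x * Real.exp (-α * x) := fun x => by
    rw [← mul_add]
    exact mul_le_mul_of_nonneg_left (exp_mul_abs_le α x) (peakonDensity_nonneg p q x)
  have hmeas : AEStronglyMeasurable (fun x => peakonDensity p q x * Real.exp (α * |x|)) :=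
    (integrable_peakonDensity_zero p q).aestronglyMeasurable.mul
      (Continuous.aestronglyMeasurable (by fun_prop))
  have hI : Integrable fun x => peakonDensity p q x * Real.exp (α * |x|) := by
    refine (hI1.add hI2).mono' hmeas (ae_of_all _ fun x => ?_)
    rw [Real.norm_of_nonneg (mul_nonneg (peakonDensity_nonneg p q x) (Real.exp_pos _).le)]
    exact hle x
  refine ⟨hI.congr hae.symm, ?_⟩
  rw [weightedEnergy, integral_congr_ae hae, expEnergy, expEnergy, ← integral_add hI1 hI2]
  exact integral_mono hI (hI1.add hI2) hle

theorem expEnergy_le_weightedEnergy {α β : ℝ} (hα : |α| < 2) (hβ : |β| ≤ α) (p q : Fin N → ℝ) :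
    expEnergy β p q ≤ weightedEnergy α (multipeakon p q) := by
  refine integral_mono_ae (integrable_peakonDensity (by linarith [le_abs_self α]) p q)
    (hasFiniteWeightedEnergy_multipeakon hα p q).1 ?_
  filter_upwards [energyDensity_multipeakon_ae p q] with x hx
  rw [hx]
  refine mul_le_mul_of_nonneg_left (Real.exp_le_exp.2 ?_) (peakonDensity_nonneg p q x)
  calc β * x ≤ |β * x| := le_abs_self _
    _ = |β| * |x| := abs_mul _ _
    _ ≤ α * |x| := mul_le_mul_of_nonneg_right hβ (abs_nonneg x)

theorem energy_multipeakon (p q : Fin N → ℝ) : energy (multipeakon p q) = expEnergy 0 p q := by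
  rw [energy, expEnergy_zero, integral_congr_ae (energyDensity_multipeakon_ae p q)]

theorem abs_exp_neg_sub_exp_neg_le {a b : ℝ} (ha : 0 ≤ a) (hb : 0 ≤ b) :
    |Real.exp (-a) - Real.exp (-b)| ≤ |a - b| := by
  have key : ∀ {a b : ℝ}, 0 ≤ a → a ≤ b → |Real.exp (-a) - Real.exp (-b)| ≤ |a - b| := by
    intro a b ha hab
    have h1 : Real.exp (-b) ≤ Real.exp (-a) := Real.exp_le_exp.2 (by linarith)
    have h2 : Real.exp (-b) = Real.exp (-a) * Real.exp (-(b - a)) := by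
      rw [← Real.exp_add]; ring_nf
    have h3 := Real.add_one_le_exp (-(b - a))
    have h4 : Real.exp (-a) ≤ 1 := Real.exp_le_one_iff.2 (by linarith)
    rw [abs_of_nonneg (by linarith), abs_sub_comm, abs_of_nonneg (by linarith), h2]
    nlinarith [Real.exp_pos (-a)]
  rcases le_total a b with h | h
  · exact key ha h
  · rw [abs_sub_comm, abs_sub_comm a]
    exact key hb h

/-- The kernel `e^{-|x-y|}` is 1-Lipschitz in `x` and fails to be differentiable only at `y = x`, a
null set, so the density itself dominates the difference quotients. -/
theorem hasDerivAt_nonlocalP {f : ℝ → ℝ}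
    (hg : Integrable fun y => f y ^ 2 + deriv f y ^ 2 / 2) (x : ℝ) :
    HasDerivAt (nonlocalP f) ((1 / 2) * ∫ y, (-Real.sign (x - y) * Real.exp (-|x - y|)) *
      (f y ^ 2 + deriv f y ^ 2 / 2)) x := by
  have hmeas : ∀ z : ℝ, AEStronglyMeasurable
      (fun y => Real.exp (-|z - y|) * (f y ^ 2 + deriv f y ^ 2 / 2)) := fun z =>
    (Continuous.aestronglyMeasurable (by fun_prop)).mul hg.aestronglyMeasurable
  have hsign : Measurable Real.sign := by
    have : Real.sign = fun r => if r < 0 then -1 else if 0 < r then 1 else 0 := by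
      ext r; rfl
    rw [this]
    exact Measurable.ite measurableSet_Iio measurable_const
      (Measurable.ite measurableSet_Ioi measurable_const measurable_const)
  refine HasDerivAt.const_mul (1 / 2) ?_
  refine (hasDerivAt_integral_of_dominated_loc_of_lip (bound := fun y => f y ^ 2 + deriv f y ^ 2 / 2)
    (s := Set.univ) univ_mem (Eventually.of_forall hmeas) ?_ ?_ ?_ hg ?_).2
  · refine hg.mono (hmeas x) (ae_of_all _ fun y => ?_)
    rw [norm_mul, Real.norm_of_nonneg (Real.exp_pos _).le]
    exact mul_le_of_le_one_left (norm_nonneg _) (Real.exp_le_one_iff.2 (by simp))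
  · refine AEStronglyMeasurable.mul ?_ hg.aestronglyMeasurable
    exact (((hsign.comp (measurable_const.sub measurable_id)).neg).mul
      (Continuous.measurable (by fun_prop))).aestronglyMeasurable
  · refine ae_of_all _ fun y => LipschitzOnWith.of_dist_le_mul fun a _ b _ => ?_
    rw [Real.dist_eq, Real.dist_eq, ← sub_mul, abs_mul, Real.coe_nnabs, mul_comm]
    refine mul_le_mul_of_nonneg_left ?_ (abs_nonneg _)
    refine (abs_exp_neg_sub_exp_neg_le (abs_nonneg _) (abs_nonneg _)).trans ?_
    refine (abs_abs_sub_abs_le_abs_sub _ _).trans_eq ?_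
    congr 1; ring
  · filter_upwards [show ∀ᵐ y : ℝ, y ≠ x by simp [ae_iff]] with y hy
    refine HasDerivAt.mul_const ?_ _
    rcases lt_or_gt_of_ne hy with h | h
    · have h1 : HasDerivAt (fun z => Real.exp (-(z - y))) (Real.exp (-(x - y)) * (-1)) x :=
        ((hasDerivAt_id x).sub_const y).neg.exp
      rw [Real.sign_of_pos (sub_pos.2 h), abs_of_pos (sub_pos.2 h)]
      refine (h1.congr_of_eventuallyEq ?_).congr_deriv (by ring)
      filter_upwards [Ioi_mem_nhds h] with z hz
      rw [abs_of_pos (sub_pos.2 hz)]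
    · have h1 : HasDerivAt (fun z => Real.exp (z - y)) (Real.exp (x - y) * 1) x :=
        ((hasDerivAt_id x).sub_const y).exp
      rw [Real.sign_of_neg (sub_neg.2 h), abs_of_neg (sub_neg.2 h), neg_neg]
      refine (h1.congr_of_eventuallyEq ?_).congr_deriv (by ring_nf)
      filter_upwards [Iio_mem_nhds h] with z hz
      rw [abs_of_neg (sub_neg.2 hz), neg_neg]

theorem integrable_of_hasFiniteWeightedEnergy {α : ℝ} {f g : ℝ → ℝ}
    (hf : HasFiniteWeightedEnergy α f) (hg : Measurable g)
    (h : ∀ x, |g x| ≤ energyDensity f x) : Integrable fun x => g x * Real.exp (α * |x|) := by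
  refine Integrable.mono' hf (hg.aestronglyMeasurable.mul
    (Continuous.aestronglyMeasurable (by fun_prop))) (ae_of_all _ fun x => ?_)
  rw [norm_mul, Real.norm_of_nonneg (Real.exp_pos _).le]
  exact mul_le_mul_of_nonneg_right (h x) (Real.exp_pos _).le

theorem nonlocalP_bound {α : ℝ} (hα₀ : 0 ≤ α) (hα₁ : α ≤ 1) {f : ℝ → ℝ} (hfc : Measurable f)
    (hf : HasFiniteWeightedEnergy α f) :
    Differentiable ℝ (nonlocalP f) ∧
      ∀ x, |deriv (nonlocalP f) x| * Real.exp (α * |x|) ≤ weightedEnergy α f := by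
  have hgm : Measurable fun y => f y ^ 2 + deriv f y ^ 2 / 2 :=
    (hfc.pow_const 2).add (((measurable_deriv f).pow_const 2).div_const 2)
  have hg0 : ∀ y, 0 ≤ f y ^ 2 + deriv f y ^ 2 / 2 := fun y => by positivity
  have hgE : ∀ y, f y ^ 2 + deriv f y ^ 2 / 2 ≤ energyDensity f y := fun y => by
    rw [energyDensity]; linarith [sq_nonneg (deriv f y)]
  have hgw := integrable_of_hasFiniteWeightedEnergy hf hgm fun y => by
    rw [abs_of_nonneg (hg0 y)]; exact hgE y
  have hg : Integrable fun y => f y ^ 2 + deriv f y ^ 2 / 2 := by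
    refine hgw.mono' hgm.aestronglyMeasurable (ae_of_all _ fun y => ?_)
    rw [Real.norm_of_nonneg (hg0 y)]
    exact le_mul_of_one_le_right (hg0 y) (Real.one_le_exp (by positivity))
  refine ⟨fun x => (hasDerivAt_nonlocalP hg x).differentiableAt, fun x => ?_⟩
  rw [(hasDerivAt_nonlocalP hg x).deriv, abs_mul, abs_of_nonneg (show (0 : ℝ) ≤ 1 / 2 by norm_num)]
  have h1 : |∫ y, (-Real.sign (x - y) * Real.exp (-|x - y|)) * (f y ^ 2 + deriv f y ^ 2 / 2)| ≤
      ∫ y, Real.exp (-(α * |x|)) * ((f y ^ 2 + deriv f y ^ 2 / 2) * Real.exp (α * |y|)) := by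
    rw [← Real.norm_eq_abs]
    refine norm_integral_le_of_norm_le (hgw.const_mul _) (ae_of_all _ fun y => ?_)
    have hs : |-Real.sign (x - y)| ≤ 1 := by
      rcases Real.sign_apply_eq (x - y) with h | h | h <;> rw [h] <;> norm_num
    -- Since `0 ≤ α ≤ 1`, `α|x| ≤ α|x - y| + α|y| ≤ |x - y| + α|y|`: the kernel decays fast enough
    -- to move the weight from `x` to `y`.
    have hexp : Real.exp (-|x - y|) ≤ Real.exp (-(α * |x|)) * Real.exp (α * |y|) := by
      rw [← Real.exp_add]
      refine Real.exp_le_exp.2 ?_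
      have h1 : |x| ≤ |x - y| + |y| := by simpa using abs_add_le (x - y) y
      nlinarith [abs_nonneg (x - y)]
    rw [norm_mul, norm_mul, Real.norm_eq_abs, Real.norm_of_nonneg (Real.exp_pos _).le,
      Real.norm_of_nonneg (hg0 y)]
    calc _ ≤ 1 * (Real.exp (-(α * |x|)) * Real.exp (α * |y|)) *
          (f y ^ 2 + deriv f y ^ 2 / 2) :=
          mul_le_mul_of_nonneg_right (mul_le_mul hs hexp (Real.exp_pos _).le zero_le_one) (hg0 y)
      _ = _ := by ring
  rw [integral_const_mul] at h1
  have h2 : ∫ y, (f y ^ 2 + deriv f y ^ 2 / 2) * Real.exp (α * |y|) ≤ weightedEnergy α f :=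
    integral_mono hgw hf fun y => mul_le_mul_of_nonneg_right (hgE y) (Real.exp_pos _).le
  have h3 := mul_le_mul_of_nonneg_right h1 (Real.exp_pos (α * |x|)).le
  have h4 : Real.exp (-(α * |x|)) * Real.exp (α * |x|) = 1 := by
    rw [← Real.exp_add]; simp
  have h5 : Real.exp (-(α * |x|)) * (∫ y, (f y ^ 2 + deriv f y ^ 2 / 2) * Real.exp (α * |y|)) *
      Real.exp (α * |x|) = ∫ y, (f y ^ 2 + deriv f y ^ 2 / 2) * Real.exp (α * |y|) := by
    rw [mul_right_comm, h4, one_mul]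
  rw [h5] at h3
  have h6 := weightedEnergy_nonneg α f
  linarith

theorem integrable_exp_neg_mul_abs {α : ℝ} (hα : 0 < α) :
    Integrable (fun x : ℝ => Real.exp (-α * |x|)) ∧ ∫ x : ℝ, Real.exp (-α * |x|) = 2 / α := by
  have hI1 := integrable_ite_lt_exp hα 0
  have hI2 := integrable_ite_le_exp (neg_lt_zero.2 hα) 0
  have hfun : (fun x : ℝ => Real.exp (-α * |x|)) = fun x =>
      (if x < 0 then Real.exp (α * x) else 0) + if 0 ≤ x then Real.exp (-α * x) else 0 := by
    ext x
    rcases lt_or_ge x 0 with h | h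
    · rw [if_pos h, if_neg h.not_ge, abs_of_neg h]; ring_nf
    · rw [if_neg h.not_gt, if_pos h, abs_of_nonneg h]; ring_nf
  rw [hfun]
  refine ⟨hI1.add hI2, ?_⟩
  rw [integral_add hI1 hI2, integral_ite_lt_exp hα, integral_ite_le_exp (neg_lt_zero.2 hα)]
  simp only [mul_zero, Real.exp_zero]
  field_simp
  norm_num

/-- Pointwise, `2|f_x| ≤ f_x² e^{α|x|} + e^{-α|x|}`; the second term has integral `2/α`, whose half
is the constant `1/α`. -/
theorem integrable_deriv_bound {α : ℝ} (hα : 0 < α) {f : ℝ → ℝ}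
    (hf : HasFiniteWeightedEnergy α f) :
    Integrable (deriv f) ∧ ∫ x, |deriv f x| ≤ weightedEnergy α f + 1 / α := by
  obtain ⟨hI, hv⟩ := integrable_exp_neg_mul_abs hα
  have hb : ∀ x, |deriv f x| ≤ (energyDensity f x * Real.exp (α * |x|) +
      Real.exp (-α * |x|)) / 2 := by
    intro x
    have h1 : deriv f x ^ 2 * Real.exp (α * |x|) ≤ energyDensity f x * Real.exp (α * |x|) :=
      mul_le_mul_of_nonneg_right (by rw [energyDensity]; linarith [sq_nonneg (f x)])
        (Real.exp_pos _).le
    have e1 : Real.exp (α * |x|) = Real.exp (α * |x| / 2) ^ 2 := by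
      rw [← Real.exp_nat_mul]; congr 1; push_cast; ring
    have e2 : Real.exp (-α * |x|) = Real.exp (-(α * |x| / 2)) ^ 2 := by
      rw [← Real.exp_nat_mul]; congr 1; push_cast; ring
    have e3 : Real.exp (α * |x| / 2) * Real.exp (-(α * |x| / 2)) = 1 := by
      rw [← Real.exp_add]; simp
    have h2 := sq_nonneg (|deriv f x| * Real.exp (α * |x| / 2) - Real.exp (-(α * |x| / 2)))
    rw [e1, ← sq_abs (deriv f x)] at h1
    rw [e1, e2]
    have h3 : (|deriv f x| * Real.exp (α * |x| / 2) - Real.exp (-(α * |x| / 2))) ^ 2 =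
        |deriv f x| ^ 2 * Real.exp (α * |x| / 2) ^ 2 + Real.exp (-(α * |x| / 2)) ^ 2 -
          2 * |deriv f x| * (Real.exp (α * |x| / 2) * Real.exp (-(α * |x| / 2))) := by ring
    rw [h3, e3] at h2
    linarith
  have hf' : Integrable fun x => energyDensity f x * Real.exp (α * |x|) := hf
  have hint := (hf'.add hI).div_const 2
  have hd : Integrable (deriv f) :=
    hint.mono' (measurable_deriv f).aestronglyMeasurable (ae_of_all _ hb)
  refine ⟨hd, (integral_mono hd.abs hint hb).trans ?_⟩
  simp only [Pi.add_apply]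
  rw [integral_div, integral_add hf' hI, hv]
  have := weightedEnergy_nonneg α f
  rw [weightedEnergy] at this ⊢
  have e : 2 / α = 2 * (1 / α) := by ring
  linarith

/-! ### The a-priori bounds -/

theorem mainTheorem1 (α : ℝ) (hα₀ : 0 < α) (hα₁ : α < 1) :
    ∃ C : ℝ → ℝ → ℝ → ℝ, (∀ K E : ℝ, Continuous (C K E)) ∧
      ∀ u : ℝ → ℝ → ℝ, IsMultipeakonSolution u → HasFiniteWeightedEnergy α (u 0) →
        ∀ t : ℝ,
          (HasFiniteWeightedEnergy α (u t) ∧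
            weightedEnergy α (u t) ≤ C (weightedEnergy α (u 0)) (energy (u 0)) t) ∧
          (Differentiable ℝ (nonlocalP (u t)) ∧
            ∀ x : ℝ, |deriv (nonlocalP (u t)) x| * Real.exp (α * |x|)
              ≤ C (weightedEnergy α (u 0)) (energy (u 0)) t) ∧
          (Integrable (deriv (u t)) ∧
            ∫ x, |deriv (u t) x| ≤ C (weightedEnergy α (u 0)) (energy (u 0)) t) := by
  -- The factor `2` counts the weights `e^{αx}` and `e^{-αx}`, each with initial energy at most `K`;
  -- the exponent is the Gronwall rate, and `1/α` is needed only for the `L¹` bound.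
  refine ⟨fun K E t => 2 * K * Real.exp (2 * √E * (3 / (2 * (1 - α))) * |t|) + 1 / α,
    fun K E => by fun_prop, ?_⟩
  rintro u ⟨N, p, q, S, hf, hu⟩ - t
  have hut : ∀ t, u t = multipeakon (p t) (q t) := fun t => funext (hu t)
  have hαabs : |α| = α := abs_of_pos hα₀
  have hα2 : |α| < 2 := by linarith
  simp only [hut, energy_multipeakon]
  obtain ⟨hfin, hle⟩ := hasFiniteWeightedEnergy_multipeakon hα2 (p t) (q t)
  have h1 := hf.expEnergy_le (β := α) (by linarith) t
  have h2 := hf.expEnergy_le (β := -α) (by rw [abs_neg]; linarith) t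
  rw [abs_neg] at h2
  rw [hαabs] at h1 h2
  have hexp := Real.exp_pos (2 * √(expEnergy 0 (p 0) (q 0)) * (3 / (2 * (1 - α))) * |t|)
  have h3 := mul_le_mul_of_nonneg_right
    (expEnergy_le_weightedEnergy (β := α) hα2 hαabs.le (p 0) (q 0)) hexp.le
  have h4 := mul_le_mul_of_nonneg_right
    (expEnergy_le_weightedEnergy (β := -α) hα2 (by rw [abs_neg, hαabs]) (p 0) (q 0)) hexp.le
  have hα' : 0 < 1 / α := by positivity
  have hK : weightedEnergy α (multipeakon (p t) (q t)) ≤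
      2 * weightedEnergy α (multipeakon (p 0) (q 0)) *
        Real.exp (2 * √(expEnergy 0 (p 0) (q 0)) * (3 / (2 * (1 - α))) * |t|) := by
    linarith
  have hmeas : Measurable (multipeakon (p t) (q t)) := by
    have : Continuous (multipeakon (p t) (q t)) := by unfold multipeakon; fun_prop
    exact this.measurable
  obtain ⟨hPd, hP⟩ := nonlocalP_bound hα₀.le hα₁.le hmeas hfin
  obtain ⟨hdi, hdv⟩ := integrable_deriv_bound hα₀ hfin
  exact ⟨⟨hfin, by linarith⟩, ⟨hPd, fun x => by linarith [hP x]⟩, hdi, by linarith⟩
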